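/- **Setting.** Let $n\ge 1$, $d\ge 1$, and let $\mathbb F$ be a finite field with $|\mathbb F|>4d$. A row $x\in\{0,1\}^d$ is Shamir-encoded as follows: pick uniformly at random distinct $\alpha_1,\dots,\alpha_{3d}\in\mathbb F$ and, independently and uniformly, $z_{d+1},\dots,z_{2d}\in\mathbb F$; let $p$ be the polynomial of degree at most $2d-1$ with $p(\alpha_j)=x_j$ and $p(\alpha_{d+j})=z_{d+j}$ for $1\le j\le d$; the share of $x$ consists of the prefix $(\alpha_1,\dots,\alpha_d)$ and the $2d$ attributes $(\alpha_{d+j},p(\alpha_{d+j}))$, $1\le j\le 2d$. In the secret-sharing problem $\mathcal P_{SS}$ the rows of a dataset $D\in(\{0,1\}^d)^n$ are encoded independently. An algorithm is a randomized adaptive procedure (with no other computational restriction) that makes attribute queries $(i,j)\in[n]\times[2d]$, each answered by the $j$-th attribute $(\alpha^{(i)}_{d+j},p_i(\alpha^{(i)}_{d+j}))$ of the $i$-th share, with the prefix of that share supplied free of charge, and that outputs a vector $a\in\mathbb R^d$. Its query complexity is at most $s$ if it makes at most $s$ attribute queries on every encoding of every dataset and for all of its coins. It is $(1/3,1/3)$-accurate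 if for every $D$, with probability at least $2/3$ over the encoding and its coins, $|a_j-\frac1n\sum_i D_{ij}|\le 1/3$ for all $j\in[d]$. It is $(\varepsilon,\delta)$-DP if for all $D,D'\in(\{0,1\}^d)^n$ differing in a single row and all measurable $E\subseteq\mathbb R^d$, the outputs on random encodings of $D$ and $D'$ satisfy $\Pr[a(D)\in E]\le e^{\varepsilon}\Pr[a(D')\in E]+\delta$. **Theorem 4.9.** Let the number of rows be polynomially bounded in the dimension. Then any algorithm for $\mathcal P_{SS}$ that is $(1/3,1/3)$-accurate and $(O(1),o(1/n))$-DP must make $s=\Omega\big(d\sqrt{d/\log d}\big)$ attribute queries. Precisely: for all $\varepsilon\in\mathbb R$ and $k\in\mathbb N$ there are constants $\gamma,c>0$ and $d_0$ such that for all $d\ge d_0$, all $1\le n\le d^k$, every finite field $\mathbb F$ with $|\mathbb F|>4d$, and every $\delta\le\gamma/n$, every algorithm with attribute query complexity at most $s$ that is $(1/3,1/3)$-accurate and $(\varepsilon,\delta)$-DP satisfies $$s\ \ge\ c\,d\sqrt{d/\log d}.$$ In particular, when $n=\Theta(\sqrt d)$ this is nearly linear in the input size $m=nd$: for the same constant $c$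 and every $B>0$ with $n\le B\sqrt d$, $$s\ \ge\ \frac cB\cdot\frac{m}{\sqrt{\log m}}.$$ -/

import Mathlib

universe u v

noncomputable section

namespace SecretSharing

/-! ### Randomized adaptive query algorithms -/

/-- A deterministic adaptive query algorithm: either stop with an output, or ask a query and continue
depending on the answer. -/
inductive DecisionTree (Q R O : Type*) where
  | output (o : O) : DecisionTree Q R O
  | query (q : Q) (next : R → DecisionTree Q R O) : DecisionTree Q R O

/-- The output when the queries are answered by `f`. -/
def DecisionTree.run {Q R O : Type*} : DecisionTree Q R O → (Q → R) → O
  | .output o, _ => o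
  | .query q next, f => (next (f q)).run f

/-- The number of queries asked when the queries are answered by `f`. -/
def DecisionTree.numQueries {Q R O : Type*} : DecisionTree Q R O → (Q → R) → ℕ
  | .output _, _ => 0
  | .query q next, f => (next (f q)).numQueries f + 1

/-- A randomized adaptive query algorithm with arbitrary internal randomness: the coins, drawn from an
arbitrary probability space, select a deterministic adaptive query algorithm. There is no restriction
on its computational power. For every oracle, the output is a random variable. -/
structure RandomizedAlgorithm (Q R : Type*) (O : Type*) [MeasurableSpace O] where
  Coins : Type u
  measurableSpaceCoins : MeasurableSpace Coins
  coinLaw : MeasureTheory.Measure Coins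
  isProbabilityMeasure : MeasureTheory.IsProbabilityMeasure coinLaw
  tree : Coins → DecisionTree Q R O
  measurable_run : ∀ f : Q → R, Measurable fun ω => (tree ω).run f

/-! ### Datasets, one-way marginals, differential privacy, accuracy -/

/-- A dataset of `n` rows from `{0,1}^d`. -/
abbrev Dataset (n d : ℕ) : Type := Fin n → Fin d → Bool

/-- The one-way marginals (column averages) of a dataset. -/
def marginal {n d : ℕ} (D : Dataset n d) (j : Fin d) : ℝ :=
  (∑ i : Fin n, if D i j then (1 : ℝ) else 0) / n

/-- Two databases of the same size are neighbours if they differ in (at most) a single row. -/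
def Neighbors {n : ℕ} {X : Type*} (D D' : Fin n → X) : Prop :=
  ∃ i : Fin n, ∀ j : Fin n, j ≠ i → D j = D' j

/-- `(ε, δ)`-differential privacy of a mechanism, given by its output law on every database. -/
def IsDP {n : ℕ} {X O : Type*} [MeasurableSpace O]
    (M : (Fin n → X) → MeasureTheory.Measure O) (ε δ : ℝ) : Prop :=
  ∀ D D' : Fin n → X, Neighbors D D' → ∀ E : Set O, MeasurableSet E →
    (M D).real E ≤ Real.exp ε * (M D').real E + δ

/-- `(α, p)`-accuracy for the one-way marginals: on every dataset, with probability at least `1 - p`,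
every released coordinate is within `α` of the corresponding marginal. -/
def IsAccurate {n d : ℕ} (M : Dataset n d → MeasureTheory.Measure (Fin d → ℝ)) (α p : ℝ) : Prop :=
  ∀ D : Dataset n d, 1 - p ≤ (M D).real {a | ∀ j : Fin d, |marginal D j - a j| ≤ α}

/-! ### The Shamir encoding -/

/-- The random choices in the encoding of one row: `3d` distinct field elements `α_1, …, α_{3d}` and
`d` field elements `z_{d+1}, …, z_{2d}` (indices are shifted to start at `0`). -/
abbrev RowSeed (F : Type v) (d : ℕ) : Type v := (Fin (3 * d) ↪ F) × (Fin d → F)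

section Shamir

variable {F : Type v} [Field F] {d : ℕ}

/-- The first `2d` evaluation points. -/
def RowSeed.node (ρ : RowSeed F d) (i : Fin (2 * d)) : F :=
  ρ.1 ⟨i.val, by omega⟩

/-- The prescribed values at the first `2d` points: the `d` bits of the row, then the `z`'s. -/
def RowSeed.value (ρ : RowSeed F d) (x : Fin d → Bool) (i : Fin (2 * d)) : F :=
  if h : i.val < d then (if x ⟨i.val, h⟩ then 1 else 0) else ρ.2 ⟨i.val - d, by omega⟩

/-- The polynomial of degree at most `2d - 1` with the prescribed values at the first `2d` points. -/
def RowSeed.poly (ρ : RowSeed F d) (x : Fin d → Bool) : Polynomial F :=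
  Lagrange.interpolate Finset.univ ρ.node (ρ.value x)

/-- The published prefix `α_1, …, α_d`. -/
def RowSeed.pre (ρ : RowSeed F d) (j : Fin d) : F :=
  ρ.1 ⟨j.val, by omega⟩

/-- The evaluation point `α_{d+j}` of the `j`-th attribute. -/
def RowSeed.point (ρ : RowSeed F d) (j : Fin (2 * d)) : F :=
  ρ.1 ⟨d + j.val, by omega⟩

/-- The oracle for the encoded dataset: the attribute query `(i, j)` is answered by the pair
`(α_{d+j}, p(α_{d+j}))` of the `i`-th row's share, and the prefix of that row is supplied with it,
free of charge. -/
def shareOracle {n : ℕ} (D : Dataset n d) (ρ : Fin n → RowSeed F d) :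
    Fin n × Fin (2 * d) → (Fin d → F) × F × F :=
  fun q => ((ρ q.1).pre, (ρ q.1).point q.2, ((ρ q.1).poly (D q.1)).eval ((ρ q.1).point q.2))

end Shamir

/-! ### The secret-sharing problem -/

/-- A randomized algorithm for the secret-sharing problem with `n` rows and dimension `d` over `F`:
it makes attribute queries to the encoded dataset and outputs a vector in `ℝ^d`. -/
abbrev Algorithm (n d : ℕ) (F : Type v) :=
  RandomizedAlgorithm.{u} (Fin n × Fin (2 * d)) ((Fin d → F) × F × F) (Fin d → ℝ)

/-- The law of the output of the algorithm on a random encoding of the dataset `D`: the rows are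
encoded independently with uniformly random seeds, and the algorithm tosses its own coins
independently of the encoding. -/
def outputLaw {n d : ℕ} {F : Type v} [Field F] [Fintype F] [DecidableEq F]
    (A : Algorithm.{u} n d F) (D : Dataset n d) : MeasureTheory.Measure (Fin d → ℝ) :=
  letI := A.measurableSpaceCoins
  (Fintype.card (Fin n → RowSeed F d) : ENNReal)⁻¹ •
    ∑ ρ : Fin n → RowSeed F d, A.coinLaw.map fun ω => (A.tree ω).run (shareOracle D ρ)

/-- Attribute query complexity at most `s`: on every encoding of every dataset, and for all coins, the
algorithm makes at most `s` attribute queries. -/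
def HasQueryComplexity {n d : ℕ} {F : Type v} [Field F] (A : Algorithm.{u} n d F) (s : ℕ) : Prop :=
  ∀ (ω : A.Coins) (D : Dataset n d) (ρ : Fin n → RowSeed F d),
    (A.tree ω).numQueries (shareOracle D ρ) ≤ s

end SecretSharing

end

/-! Secrecy turns queries into rows. Any `d` attributes of a share have a law that does not depend
on its row (`isSecret_rowShare`), so a row matters only from its `(d + 1)`-st query on, and `s`
queries reveal at most `s / (d + 1)` rows. If the choice of a row is deferred until it is revealed,
the algorithm behaves as if rows `Y 0, Y 1, …` were shown to it one after the other. A bound that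
holds wherever these rows sit in the dataset therefore transfers to the algorithm
(`sum_sum_run_le`).

What remains is a fingerprinting argument with `m` visible rows among `n`. In every column a mean
`p` is drawn from the density `prior`, and the entries of the dataset and of a reference row `x` are
independent Bernoulli(`p`) bits. The score of row `i` is the correlation of the centred, clipped
estimates with `D i - x`.

Privacy keeps scores small. Exchanging row `i` with a fresh row costs a factor `exp ε` and a term
`δ`; afterwards the score compares two exchangeable rows that the output does not depend on, and its
tail is at most `exp (-2 t² / d)`. A union bound over the `n` rows gives `two_thirds_le_undetected`.

Accuracy makes scores large. Integration by parts in `p` shows that an accurate estimate correlates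
with the entries it was computed from, by a constant per column (`sum_columnValue_le`). The estimate
for one column may depend on all columns of `Y`; maximising each column's contribution over the
estimate (`bestValue`) makes the exponential moment factor over the columns. With `t` of order `d /
m`, being accurate while every score is at most `t` has probability at most `exp (-c d / m²)`
(`sum_undetected_le`).

If `d / m²` exceeded a large multiple of `log d`, these two bounds would contradict each other.
Hence `m` is at least of order `√(d / log d)`, and `s` at least of order `d * m`. -/

namespace SecretSharing

open Finset

/-! ### Deferred decisions: few queries reveal few rows -/

section Simulation

variable {ι X S J R O : Type*}

/-- The indicator that the share of `x` encoded with seed `ρ` agrees with the recorded answers `K`. -/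
def agree [DecidableEq R] (f : X → S → J → R) (x : X) (ρ : S) (K : List (J × R)) : ℝ :=
  if ∀ q ∈ K, f x ρ q.1 = q.2 then 1 else 0

/-- The number of seeds for which the share of `x` agrees with the recorded answers `K`. -/
def agreeCount [DecidableEq R] [Fintype S] (f : X → S → J → R) (x : X) (K : List (J × R)) : ℝ :=
  ∑ ρ : S, agree f x ρ K

/-- Any `b` answers about a share are distributed independently of the encoded row. -/
def IsSecret [DecidableEq R] [Fintype S] (f : X → S → J → R) (b : ℕ) : Prop :=
  ∀ K : List (J × R), K.length ≤ b → ∀ x x' : X, agreeCount f x K = agreeCount f x' K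

/-- The oracle of an encoded dataset. -/
def encOracle (f : X → S → J → R) (D : ι → X) (ρ : ι → S) : ι × J → R :=
  fun q => f (D q.1) (ρ q.1) q.2

/-- Record one more answer. -/
def record [DecidableEq ι] (K : ι → List (J × R)) (q : ι × J) (r : R) : ι → List (J × R) :=
  Function.update K q.1 ((q.2, r) :: K q.1)

/-- The rows with more than `b` recorded answers. -/
def cracked [Fintype ι] (b : ℕ) (K : ι → List (J × R)) : Finset ι :=
  univ.filter fun i => b < (K i).length

/-- Extend a vector of length `m` to a sequence. -/
def extendSeq {m : ℕ} (x₀ : X) (Y : Fin m → X) (l : ℕ) : X :=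
  if h : l < m then Y ⟨l, h⟩ else x₀

lemma agree_cons [DecidableEq R] (f : X → S → J → R) (x : X) (ρ : S) (K : List (J × R))
    (j : J) (r : R) :
    agree f x ρ ((j, r) :: K) = if f x ρ j = r then agree f x ρ K else 0 := by
  unfold agree
  by_cases h : f x ρ j = r <;> simp only [List.forall_mem_cons, h, true_and, if_true, false_and, if_false]

lemma agree_nonneg [DecidableEq R] (f : X → S → J → R) (x : X) (ρ : S) (K : List (J × R)) :
    0 ≤ agree f x ρ K := by
  unfold agree; split_ifs <;> norm_num

lemma agreeCount_nonneg [DecidableEq R] [Fintype S] (f : X → S → J → R) (x : X)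
    (K : List (J × R)) : 0 ≤ agreeCount f x K :=
  sum_nonneg fun _ _ => agree_nonneg ..

lemma sum_agreeCount_cons [DecidableEq R] [Fintype R] [Fintype S] (f : X → S → J → R) (x : X)
    (K : List (J × R)) (j : J) : ∑ r, agreeCount f x ((j, r) :: K) = agreeCount f x K := by
  unfold agreeCount
  rw [sum_comm]
  simp [agree_cons]

lemma agreeCount_nil [DecidableEq R] [Fintype S] (f : X → S → J → R) (x : X) :
    agreeCount f x [] = Fintype.card S := by
  simp [agreeCount, agree]

lemma prod_agree_record [Fintype ι] [DecidableEq ι] [DecidableEq R] (f : X → S → J → R)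
    (D : ι → X) (ρ : ι → S) (K : ι → List (J × R)) (q : ι × J) (r : R) :
    ∏ i, agree f (D i) (ρ i) (record K q r i) =
      if encOracle f D ρ q = r then ∏ i, agree f (D i) (ρ i) (K i) else 0 := by
  rw [← mul_prod_erase univ _ (mem_univ q.1), ← mul_prod_erase univ (fun i => agree f (D i) (ρ i) (K i)) (mem_univ q.1)]
  have h : ∏ i ∈ univ.erase q.1, agree f (D i) (ρ i) (record K q r i) =
      ∏ i ∈ univ.erase q.1, agree f (D i) (ρ i) (K i) :=
    prod_congr rfl fun i hi => by rw [record, Function.update_of_ne (ne_of_mem_erase hi)]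
  rw [h]
  have h' : agree f (D q.1) (ρ q.1) (record K q r q.1) =
      if encOracle f D ρ q = r then agree f (D q.1) (ρ q.1) (K q.1) else 0 := by
    rw [record, Function.update_self, agree_cons]
    rfl
  rw [h']
  split_ifs <;> simp

/-- Each seed gives exactly one answer to the query, so splitting by the answer preserves the total
count. This lets the bound telescope along the tree. -/
lemma sum_prod_agreeCount_record [Fintype ι] [DecidableEq ι] [DecidableEq R] [Fintype R]
    [Fintype S] (f : X → S → J → R) (D : ι → X) (K : ι → List (J × R)) (q : ι × J) :
    ∑ r, ∏ i, agreeCount f (D i) (record K q r i) = ∏ i, agreeCount f (D i) (K i) := by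
  have h (r : R) : ∏ i, agreeCount f (D i) (record K q r i) =
      agreeCount f (D q.1) ((q.2, r) :: K q.1) * ∏ i ∈ univ.erase q.1, agreeCount f (D i) (K i) := by
    rw [← mul_prod_erase univ _ (mem_univ q.1)]
    congr 1
    · simp [record]
    · exact prod_congr rfl fun i hi => by rw [record, Function.update_of_ne (ne_of_mem_erase hi)]
  simp only [h]
  rw [← sum_mul, sum_agreeCount_cons, mul_prod_erase univ (fun i => agreeCount f (D i) (K i)) (mem_univ q.1)]

lemma sum_prod_agree [Fintype ι] [DecidableEq ι] [DecidableEq R] [Fintype S] (f : X → S → J → R)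
    (D : ι → X) (K : ι → List (J × R)) :
    ∑ ρ : ι → S, ∏ i, agree f (D i) (ρ i) (K i) = ∏ i, agreeCount f (D i) (K i) := by
  unfold agreeCount
  rw [prod_univ_sum, Fintype.piFinset_univ]

lemma length_record [DecidableEq ι] (K : ι → List (J × R)) (q : ι × J) (r : R) (i : ι) :
    (record K q r i).length = if i = q.1 then (K i).length + 1 else (K i).length := by
  unfold record
  split_ifs with h
  · subst h; simp
  · simp [Function.update_of_ne h]

lemma sum_length_record [Fintype ι] [DecidableEq ι] (K : ι → List (J × R)) (q : ι × J) (r : R) :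
    ∑ i, (record K q r i).length = ∑ i, (K i).length + 1 := by
  have h (i : ι) : (record K q r i).length = (K i).length + if i = q.1 then 1 else 0 := by
    rw [length_record]; split_ifs <;> rfl
  simp [h, sum_add_distrib]

/-- If a row becomes cracked, it takes the next free slot. -/
def nextSlot [Fintype ι] [DecidableEq ι] (b : ℕ) (K : ι → List (J × R)) (slot : ι → ℕ) (i : ι) :
    ι → ℕ :=
  if (K i).length = b then Function.update slot i (cracked b K).card else slot

/-- The cracked rows occupy distinct slots, numbered from `0` on. -/
def SlotsOK [Fintype ι] (b : ℕ) (K : ι → List (J × R)) (slot : ι → ℕ) : Prop :=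
  Set.InjOn slot (cracked b K : Set ι) ∧ ∀ i ∈ cracked b K, slot i < (cracked b K).card

/-- A row with exactly `b` answers becomes cracked at its next query and takes the number of rows
cracked so far, which exceeds every slot in use. Slots of uncracked rows are arbitrary. -/
lemma SlotsOK.record [Fintype ι] [DecidableEq ι] {b : ℕ} {K : ι → List (J × R)} {slot : ι → ℕ}
    (h : SlotsOK b K slot) (q : ι × J) (r : R) :
    SlotsOK b (record K q r) (nextSlot b K slot q.1) := by
  by_cases hb : (K q.1).length = b
  · have hq : q.1 ∉ cracked b K := by simp [cracked, hb]
    have hc : cracked b (SecretSharing.record K q r) = insert q.1 (cracked b K) := by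
      ext i
      by_cases hi : i = q.1
      · subst hi; simp [cracked, length_record, hb]
      · simp [cracked, length_record, hi]
    have hne {i : ι} (hi : i ∈ cracked b K) : i ≠ q.1 := fun e => hq (e ▸ hi)
    unfold SlotsOK
    rw [hc, card_insert_of_notMem hq, nextSlot, if_pos hb, coe_insert, Set.injOn_insert (by simpa using hq)]
    refine ⟨⟨?_, ?_⟩, ?_⟩
    · refine h.1.congr fun i hi => ?_
      rw [Function.update_of_ne (hne hi)]
    · rintro ⟨i, hi, e⟩
      rw [Function.update_self, Function.update_of_ne (hne hi)] at e
      exact (h.2 i hi).ne e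
    · intro i hi
      rcases mem_insert.1 hi with rfl | hi
      · simp
      · rw [Function.update_of_ne (hne hi)]
        exact (h.2 i hi).trans (Nat.lt_succ_self _)
  · have hc : cracked b (SecretSharing.record K q r) = cracked b K := by
      ext i
      by_cases hi : i = q.1
      · subst hi; simp [cracked, length_record]; omega
      · simp [cracked, length_record, hi]
    unfold SlotsOK
    rw [hc, nextSlot, if_neg hb]
    exact h

/-- A slot is reassigned only while its row has exactly `b` answers, so by secrecy the reassignment
is invisible. -/
lemma prod_agreeCount_nextSlot [Fintype ι] [DecidableEq ι] [DecidableEq R] [Fintype S]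
    {f : X → S → J → R} {b : ℕ} (hf : IsSecret f b) (Y : ℕ → X) (K : ι → List (J × R))
    (slot : ι → ℕ) (i₀ : ι) :
    ∏ i, agreeCount f (Y (nextSlot b K slot i₀ i)) (K i) = ∏ i, agreeCount f (Y (slot i)) (K i) := by
  refine prod_congr rfl fun i _ => ?_
  unfold nextSlot
  split_ifs with hb
  · by_cases hi : i = i₀
    · subst hi; exact hf _ hb.le _ _
    · rw [Function.update_of_ne hi]
  · rfl

lemma card_cracked_mul_le [Fintype ι] (b : ℕ) (K : ι → List (J × R)) :
    (cracked b K).card * (b + 1) ≤ ∑ i, (K i).length := by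
  calc (cracked b K).card * (b + 1) = ∑ i ∈ cracked b K, (b + 1) := by simp
    _ ≤ ∑ i ∈ cracked b K, (K i).length :=
        sum_le_sum fun i hi => by simpa [cracked, Nat.succ_le_iff] using hi
    _ ≤ ∑ i, (K i).length := sum_le_univ_sum_of_nonneg fun _ => Nat.zero_le _

/-- The slots are injective on the cracked rows and below `m`, so they extend to a bijection; the
remaining rows are placed arbitrarily. -/
lemma SlotsOK.exists_equiv [Fintype ι] [DecidableEq ι] {κ : Type*} [Fintype κ] {b m : ℕ}
    {K : ι → List (J × R)} {slot : ι → ℕ} (h : SlotsOK b K slot) (hm : (cracked b K).card ≤ m)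
    (hcard : Fintype.card ι = m + Fintype.card κ) :
    ∃ e : ι ≃ Fin m ⊕ κ, ∀ i ∈ cracked b K, ∃ hi : slot i < m, e i = Sum.inl ⟨slot i, hi⟩ := by
  classical
  by_cases h0 : m = 0
  · subst h0
    have hc : cracked b K = ∅ := card_eq_zero.1 (Nat.le_zero.1 hm)
    have hcard' : Fintype.card ι = Fintype.card (Fin 0 ⊕ κ) := by simp [hcard]
    exact ⟨Fintype.equivOfCardEq hcard', by simp [hc]⟩
  · have : NeZero m := ⟨h0⟩
    let g : ι → Fin m ⊕ κ := fun i => Sum.inl (Fin.ofNat m (slot i))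
    have hlt {i : ι} (hi : i ∈ cracked b K) : slot i < m := (h.2 i hi).trans_le hm
    have hg {i : ι} (hi : i ∈ cracked b K) : g i = Sum.inl ⟨slot i, hlt hi⟩ := by
      simp [g, Fin.ext_iff, Nat.mod_eq_of_lt (hlt hi)]
    obtain ⟨e, he⟩ := Finset.exists_equiv_extend_of_card_eq (α := ι) (t := (univ : Finset (Fin m ⊕ κ)))
      (by simp [hcard]) (s := cracked b K) (f := g) (subset_univ _) (by
        intro i hi i' hi' e
        rw [hg hi, hg hi'] at e
        exact h.1 hi hi' (by simpa using e))
    refine ⟨e.trans (Equiv.subtypeUnivEquiv (by simp)), fun i hi => ⟨hlt hi, ?_⟩⟩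
    rw [← hg hi, ← he i hi]
    rfl

/-- A tree that asks at most `s` attribute queries, to shares of which any `b` attributes are secret,
learns about no more than `m` rows, and it sees these rows as if they were presented one after the
other. -/
theorem sum_sum_run_le_aux [Fintype ι] [DecidableEq ι] [Fintype X] [Fintype S] [Fintype R]
    [DecidableEq R] {κ : Type*} [Fintype κ] [DecidableEq κ] {f : X → S → J → R} {b m s : ℕ}
    (hf : IsSecret f b) (hcard : Fintype.card ι = m + Fintype.card κ)
    (hm : ∀ c : ℕ, c ≤ Fintype.card ι → c * (b + 1) ≤ s → c ≤ m)
    (x₀ : X) (G : (ι → X) → O → ℝ) (T : (Fin m → X) → ℝ) (hT : ∀ Y, 0 ≤ T Y)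
    (hGT : ∀ (o : O) (e : ι ≃ Fin m ⊕ κ) (Y : Fin m → X),
      ∑ U : κ → X, G (Sum.elim Y U ∘ e) o ≤ T Y)
    (t : DecisionTree (ι × J) R O) :
    ∀ (K : ι → List (J × R)) (slot : ι → ℕ), SlotsOK b K slot →
    (∀ (D : ι → X) (ρ : ι → S), ∏ i, agree f (D i) (ρ i) (K i) ≠ 0 →
      t.numQueries (encOracle f D ρ) + ∑ i, (K i).length ≤ s) →
    ∑ D : ι → X, ∑ ρ : ι → S, (∏ i, agree f (D i) (ρ i) (K i)) * G D (t.run (encOracle f D ρ)) ≤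
      ∑ Y : Fin m → X, T Y * ∏ i, agreeCount f (extendSeq x₀ Y (slot i)) (K i) := by
  induction t with
  | output o =>
    intro K slot hslot hq
    simp only [DecisionTree.run, ← sum_mul, sum_prod_agree]
    have hR : 0 ≤ ∑ Y : Fin m → X, T Y * ∏ i, agreeCount f (extendSeq x₀ Y (slot i)) (K i) :=
      sum_nonneg fun Y _ => mul_nonneg (hT Y) (prod_nonneg fun _ _ => agreeCount_nonneg ..)
    -- The query bound is known only for encodings consistent with `K`. At an unreachable leaf there
    -- are none, and the left side is zero.
    by_cases hz : ∃ (D : ι → X) (ρ : ι → S), ∏ i, agree f (D i) (ρ i) (K i) ≠ 0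
    swap
    · push Not at hz
      refine le_of_eq_of_le (sum_eq_zero fun D _ => ?_) hR
      rw [← sum_prod_agree, sum_eq_zero fun ρ _ => hz D ρ, zero_mul]
    obtain ⟨D, ρ, hDρ⟩ := hz
    have hs := hq D ρ hDρ
    have hcm : (cracked b K).card ≤ m :=
      hm _ (card_le_univ _) ((card_cracked_mul_le b K).trans ((Nat.le_add_left _ _).trans hs))
    obtain ⟨e, he⟩ := hslot.exists_equiv (κ := κ) hcm hcard
    -- Cracked rows sit in their slots under `e`; for every other row secrecy makes the choice of
    -- row irrelevant.
    have hw (Y : Fin m → X) (U : κ → X) :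
        ∏ i, agreeCount f ((Sum.elim Y U ∘ e) i) (K i) =
          ∏ i, agreeCount f (extendSeq x₀ Y (slot i)) (K i) := by
      refine prod_congr rfl fun i _ => ?_
      by_cases hi : i ∈ cracked b K
      · obtain ⟨hi, h⟩ := he i hi
        simp [h, extendSeq, hi]
      · exact hf _ (by simpa [cracked] using hi) _ _
    let E : ((Fin m → X) × (κ → X)) ≃ (ι → X) :=
      (Equiv.sumArrowEquivProdArrow (Fin m) κ X).symm.trans (e.arrowCongr (Equiv.refl X)).symm
    have hE (p : (Fin m → X) × (κ → X)) : E p = Sum.elim p.1 p.2 ∘ e := rfl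
    rw [← E.sum_comp, Fintype.sum_prod_type]
    refine sum_le_sum fun Y _ => ?_
    simp only [hE, hw]
    rw [← mul_sum, mul_comm]
    exact mul_le_mul_of_nonneg_right (hGT o e Y) (prod_nonneg fun _ _ => agreeCount_nonneg ..)
  | query q next ih =>
    intro K slot hslot hq
    have hsplit (D : ι → X) (ρ : ι → S) :
        (∏ i, agree f (D i) (ρ i) (K i)) *
            G D ((DecisionTree.query q next).run (encOracle f D ρ)) =
          ∑ r, (∏ i, agree f (D i) (ρ i) (record K q r i)) *
            G D ((next r).run (encOracle f D ρ)) := by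
      simp only [prod_agree_record, ite_mul, zero_mul, sum_ite_eq, mem_univ, if_true,
        DecisionTree.run]
    have hL : ∑ D : ι → X, ∑ ρ : ι → S, (∏ i, agree f (D i) (ρ i) (K i)) *
            G D ((DecisionTree.query q next).run (encOracle f D ρ)) =
        ∑ r, ∑ D : ι → X, ∑ ρ : ι → S, (∏ i, agree f (D i) (ρ i) (record K q r i)) *
            G D ((next r).run (encOracle f D ρ)) := by
      simp only [hsplit]
      rw [sum_congr rfl fun D _ => sum_comm, sum_comm]
    rw [hL]
    -- The slot is assigned before the answer is known, so all branches use the same slots and their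
    -- bounds add up.
    refine (sum_le_sum fun r _ => ih r (record K q r) (nextSlot b K slot q.1) (hslot.record q r) ?_).trans
      (le_of_eq ?_)
    · intro D ρ h
      rw [prod_agree_record] at h
      have h1 : encOracle f D ρ q = r := by by_contra h'; simp [h'] at h
      rw [if_pos h1] at h
      have := hq D ρ h
      rw [sum_length_record]
      simp only [DecisionTree.numQueries, h1] at this
      omega
    · rw [sum_comm]
      refine sum_congr rfl fun Y _ => ?_
      rw [← mul_sum, sum_prod_agreeCount_record f (fun i => extendSeq x₀ Y (nextSlot b K slot q.1 i)),
        prod_agreeCount_nextSlot hf]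

/-- All leaves are charged the same `T Y`, whichever rows they revealed and in whatever order, so
the counts sum to the number of seeds. -/
theorem sum_sum_run_le [Fintype ι] [DecidableEq ι] [Fintype X] [Nonempty X] [Fintype S] [Fintype R]
    [DecidableEq R] {κ : Type*} [Fintype κ] [DecidableEq κ] {f : X → S → J → R} {b m s : ℕ}
    (hf : IsSecret f b) (hcard : Fintype.card ι = m + Fintype.card κ)
    (hm : ∀ c : ℕ, c ≤ Fintype.card ι → c * (b + 1) ≤ s → c ≤ m)
    (G : (ι → X) → O → ℝ) (T : (Fin m → X) → ℝ) (hT : ∀ Y, 0 ≤ T Y)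
    (hGT : ∀ (o : O) (e : ι ≃ Fin m ⊕ κ) (Y : Fin m → X),
      ∑ U : κ → X, G (Sum.elim Y U ∘ e) o ≤ T Y)
    (t : DecisionTree (ι × J) R O)
    (ht : ∀ (D : ι → X) (ρ : ι → S), t.numQueries (encOracle f D ρ) ≤ s) :
    ∑ D : ι → X, ∑ ρ : ι → S, G D (t.run (encOracle f D ρ)) ≤
      (Fintype.card (ι → S) : ℝ) * ∑ Y : Fin m → X, T Y := by
  have h := sum_sum_run_le_aux hf hcard hm (Classical.arbitrary X) G T hT hGT t (fun _ => []) (fun _ => 0)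
    (by simp [SlotsOK, cracked]) (fun D ρ _ => by simpa using ht D ρ)
  simp only [agreeCount_nil] at h
  have h1 (D : ι → X) (ρ : ι → S) : ∏ i, agree f (D i) (ρ i) ([] : List (J × R)) = 1 := by
    simp [agree]
  simp only [h1, one_mul, ← sum_mul] at h
  refine h.trans (le_of_eq ?_)
  rw [mul_comm]
  simp

end Simulation

end SecretSharing

namespace SecretSharing

open Finset Polynomial

/-! ### Secrecy of the Shamir shares -/

section ShamirSecrecy

variable {F : Type*} {d : ℕ}

lemma node_injective (α : Fin (3 * d) ↪ F) (z : Fin d → F) :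
    Function.Injective (RowSeed.node (α, z)) := by
  intro i i' h
  have := α.injective h
  simpa [Fin.ext_iff] using this

variable [Field F]

/-- The answer to an attribute query for the share of the row `x`. -/
noncomputable def rowShare (x : Fin d → Bool) (ρ : RowSeed F d) (j : Fin (2 * d)) : (Fin d → F) × F × F :=
  (ρ.pre, ρ.point j, (ρ.poly x).eval (ρ.point j))

lemma degree_poly_lt (ρ : RowSeed F d) (x : Fin d → Bool) : (ρ.poly x).degree < (2 * d : ℕ) := by
  have := Lagrange.degree_interpolate_lt (s := univ) (ρ.value x) (node_injective ρ.1 ρ.2).injOn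
  simpa [RowSeed.poly] using this

lemma eval_poly_node (ρ : RowSeed F d) (x : Fin d → Bool) (i : Fin (2 * d)) :
    (ρ.poly x).eval (ρ.node i) = ρ.value x i :=
  Lagrange.eval_interpolate_at_node _ (node_injective ρ.1 ρ.2).injOn (mem_univ i)

/-- A polynomial that moves the row `x` to the row `x'` and is invisible at the attributes in `J`. -/
lemma exists_shift (α : Fin (3 * d) ↪ F) (x x' : Fin d → Bool) (J : Finset (Fin (2 * d)))
    (hJ : J.card ≤ d) :
    ∃ e : F[X], e.degree < (2 * d : ℕ) ∧
      (∀ j : Fin d, e.eval (α ⟨j, by omega⟩) = (if x' j then 1 else 0) - (if x j then 1 else 0)) ∧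
      ∀ j ∈ J, e.eval (α ⟨d + j, by omega⟩) = 0 := by
  classical
  let v : Fin d ⊕ Fin (2 * d) → F :=
    Sum.elim (fun j => α ⟨j, by omega⟩) fun j => α ⟨d + j, by omega⟩
  let r : Fin d ⊕ Fin (2 * d) → F :=
    Sum.elim (fun j => (if x' j then 1 else 0) - (if x j then 1 else 0)) 0
  have hv : Function.Injective v := by
    rintro (i | i) (j | j) h <;> have := congrArg Fin.val (α.injective h) <;>
      simp only [Sum.inl.injEq, Sum.inr.injEq, Fin.ext_iff, reduceCtorEq] at this ⊢ <;> omega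
  refine ⟨Lagrange.interpolate (univ.disjSum J) v r, ?_, fun j => ?_, fun j hj => ?_⟩
  · refine (Lagrange.degree_interpolate_lt r hv.injOn).trans_le ?_
    rw [card_disjSum]
    simp only [card_univ, Fintype.card_fin]
    -- The `d` prefix conditions and at most `d` queried points leave the degree below `2 * d`; this
    -- fixes the secrecy threshold `d`.
    exact_mod_cast (by omega : d + J.card ≤ 2 * d)
  · exact Lagrange.eval_interpolate_at_node (i := Sum.inl j) r hv.injOn (by simp)
  · exact Lagrange.eval_interpolate_at_node (i := Sum.inr j) r hv.injOn (by simpa using hj)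

/-- Both sides have degree below `2 * d` and agree at the `2 * d` nodes: on the prefix `e` turns `x`
into `x'`, and at the other nodes the change of `z` absorbs `e`. -/
lemma poly_shift (α : Fin (3 * d) ↪ F) (z : Fin d → F) (x x' : Fin d → Bool) (e : F[X])
    (he : e.degree < (2 * d : ℕ))
    (hx : ∀ j : Fin d,
      e.eval (α ⟨j, by omega⟩) = (if x' j then 1 else 0) - (if x j then 1 else 0)) :
    RowSeed.poly (α, z + fun j : Fin d => e.eval (α ⟨d + j, by omega⟩)) x' = RowSeed.poly (α, z) x + e := by
  symm
  refine Lagrange.eq_interpolate_of_eval_eq _ (node_injective α _).injOn ?_ fun i _ => ?_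
  · simpa using (degree_add_le _ _).trans_lt (max_lt (degree_poly_lt (α, z) x) he)
  · have h1 := eval_poly_node (α, z) x i
    have h2 : RowSeed.node (α, z + fun j : Fin d => e.eval (α ⟨d + j, by omega⟩)) i =
        RowSeed.node (α, z) i := rfl
    rw [h2, eval_add, h1]
    by_cases hi : i.val < d
    · have := hx ⟨i, hi⟩
      simp only [RowSeed.node, RowSeed.value, dif_pos hi] at this ⊢
      rw [this]
      ring
    · have : (⟨d + (i.val - d), by omega⟩ : Fin (3 * d)) = ⟨i.val, by omega⟩ := by
        ext; simp only; omega
      simp [RowSeed.node, RowSeed.value, dif_neg hi, this]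

/-- Any `d` attributes of a share are distributed independently of the row. -/
lemma isSecret_rowShare [Fintype F] [DecidableEq F] :
    IsSecret (rowShare : (Fin d → Bool) → RowSeed F d → Fin (2 * d) → (Fin d → F) × F × F) d := by
  classical
  intro K hK x x'
  unfold agreeCount
  rw [Fintype.sum_prod_type, Fintype.sum_prod_type]
  refine sum_congr rfl fun α _ => ?_
  have hJ : (K.map Prod.fst).toFinset.card ≤ d :=
    (List.toFinset_card_le _).trans (by simpa using hK)
  obtain ⟨e, he, hx, h0⟩ := exists_shift α x x' _ hJ
  -- The points `α` stay fixed, so the prefix is unchanged and `e` does not depend on `z`: the shift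
  -- of `z` is a bijection of seeds.
  refine Fintype.sum_equiv (Equiv.addRight fun j : Fin d => e.eval (α ⟨d + j, by omega⟩)) _ _ fun z => ?_
  have hiff : (∀ q ∈ K, rowShare x (α, z) q.1 = q.2) ↔
      ∀ q ∈ K, rowShare x' (α, z + fun j : Fin d => e.eval (α ⟨d + j, by omega⟩)) q.1 = q.2 := by
    refine forall₂_congr fun q hq => ?_
    have h2 : e.eval (α ⟨d + q.1, by omega⟩) = 0 :=
      h0 q.1 (List.mem_toFinset.2 (List.mem_map_of_mem hq))
    simp only [rowShare, RowSeed.point, poly_shift α z x x' e he hx, eval_add, h2, add_zero]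
    rfl
  unfold agree
  rw [Equiv.coe_addRight]
  by_cases h : ∀ q ∈ K, rowShare x (α, z) q.1 = q.2
  · rw [if_pos h, if_pos (hiff.1 h)]
  · rw [if_neg h, if_neg (mt hiff.2 h)]

end ShamirSecrecy

end SecretSharing

namespace SecretSharing

open Finset MeasureTheory

/-! ### Random columns and the fingerprinting identity -/

noncomputable section Urn

/-- The value of a bit. -/
def bit (b : Bool) : ℝ := if b then 1 else 0

/-- The probability of the bit `b` under the Bernoulli law with mean `p`. -/
def bern (p : ℝ) (b : Bool) : ℝ := if b then p else 1 - p

/-- The probability of the column `c` when its entries are independent with mean `p`. -/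
def colWeight {ι : Type*} [Fintype ι] (p : ℝ) (c : ι → Bool) : ℝ := ∏ i, bern p (c i)

/-- The number of ones in a column. -/
def ones {ι : Type*} [Fintype ι] (c : ι → Bool) : ℝ := ∑ i, bit (c i)

/-- The density of the mean of a column. -/
def prior (p : ℝ) : ℝ := 3 * (1 / 4 + (p - 1 / 2) ^ 2)

/-- Truncation to `[0, 1]`. -/
def clip (a : ℝ) : ℝ := max 0 (min 1 a)

variable {ι κ : Type*} [Fintype ι] [Fintype κ]

lemma bit_nonneg (b : Bool) : 0 ≤ bit b := by unfold bit; split_ifs <;> norm_num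

lemma bit_le_one (b : Bool) : bit b ≤ 1 := by unfold bit; split_ifs <;> norm_num

lemma ones_nonneg (c : ι → Bool) : 0 ≤ ones c := sum_nonneg fun _ _ => bit_nonneg _

lemma ones_le_card (c : ι → Bool) : ones c ≤ Fintype.card ι := by
  calc ones c ≤ ∑ _i : ι, (1 : ℝ) := sum_le_sum fun _ _ => bit_le_one _
    _ = Fintype.card ι := by simp

lemma clip_nonneg (a : ℝ) : 0 ≤ clip a := le_max_left _ _

lemma clip_le_one (a : ℝ) : clip a ≤ 1 := max_le zero_le_one (min_le_left _ _)

lemma abs_clip_sub_half_le (a : ℝ) : |clip a - 1 / 2| ≤ 1 / 2 := by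
  rw [abs_le]; constructor <;> linarith [clip_nonneg a, clip_le_one a]

lemma abs_clip_sub_le {a μ : ℝ} (h0 : 0 ≤ μ) (h1 : μ ≤ 1) : |clip a - μ| ≤ |μ - a| := by
  unfold clip
  rcases le_total 1 a with h | h
  · rw [min_eq_left h, max_eq_right zero_le_one, abs_of_nonneg (by linarith), abs_of_nonpos (by linarith)]
    linarith
  · rw [min_eq_right h]
    rcases le_total 0 a with h' | h'
    · rw [max_eq_right h', abs_sub_comm]
    · rw [max_eq_left h', abs_of_nonpos (by linarith), abs_of_nonneg (by linarith)]
      linarith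

lemma measurable_clip : Measurable clip := by
  unfold clip; fun_prop

lemma bern_nonneg {p : ℝ} (hp : p ∈ Set.Icc (0 : ℝ) 1) (b : Bool) : 0 ≤ bern p b := by
  unfold bern; split_ifs <;> linarith [hp.1, hp.2]

lemma sum_bern (p : ℝ) : ∑ b, bern p b = 1 := by simp [bern]

lemma colWeight_nonneg {p : ℝ} (hp : p ∈ Set.Icc (0 : ℝ) 1) (c : ι → Bool) : 0 ≤ colWeight p c :=
  prod_nonneg fun _ _ => bern_nonneg hp _

lemma prior_nonneg (p : ℝ) : 0 ≤ prior p := by unfold prior; positivity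

@[fun_prop]
lemma continuous_bern (b : Bool) : Continuous fun p => bern p b := by
  unfold bern; split_ifs <;> fun_prop

@[fun_prop]
lemma continuous_colWeight (c : ι → Bool) : Continuous fun p => colWeight p c := by
  unfold colWeight; fun_prop

@[fun_prop]
lemma continuous_prior : Continuous prior := by
  unfold prior; fun_prop

lemma colWeight_elim (p : ℝ) (y : ι → Bool) (u : κ → Bool) :
    colWeight p (Sum.elim y u) = colWeight p y * colWeight p u := by
  simp [colWeight, Fintype.prod_sum_type]

lemma colWeight_comp (p : ℝ) (e : ι ≃ κ) (c : κ → Bool) : colWeight p (c ∘ e) = colWeight p c :=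
  Fintype.prod_equiv e _ _ fun _ => rfl

lemma ones_elim (y : ι → Bool) (u : κ → Bool) : ones (Sum.elim y u) = ones y + ones u := by
  simp [ones, Fintype.sum_sum_type]

lemma ones_comp (e : ι ≃ κ) (c : κ → Bool) : ones (c ∘ e) = ones c :=
  Fintype.sum_equiv e _ _ fun _ => rfl

lemma sum_colWeight [DecidableEq ι] (p : ℝ) : ∑ c : ι → Bool, colWeight p c = 1 := by
  have := prod_univ_sum (fun _ : ι => (univ : Finset Bool)) fun _ b => bern p b
  rw [Fintype.piFinset_univ] at this
  simp only [sum_bern, prod_const_one] at this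
  exact this.symm

lemma sum_colWeight_mul_ones [DecidableEq ι] (p : ℝ) :
    ∑ c : ι → Bool, colWeight p c * ones c = Fintype.card ι * p := by
  have h (i : ι) : ∑ c : ι → Bool, colWeight p c * bit (c i) = p := by
    have := prod_univ_sum (fun _ : ι => (univ : Finset Bool))
      fun i' b => bern p b * if i' = i then bit b else 1
    rw [Fintype.piFinset_univ, Fintype.prod_eq_single i] at this
    · simp only [prod_mul_distrib, prod_ite_eq', mem_univ, if_true] at this
      rw [show ∑ c : ι → Bool, colWeight p c * bit (c i) = _ from this.symm]
      simp [bern, bit]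
    · intro i' hi'
      simp [hi', bern]
  unfold ones
  simp only [mul_sum]
  rw [sum_comm]
  simp [h]

lemma hasDerivAt_bern (p : ℝ) (b : Bool) :
    HasDerivAt (fun p => bern p b) (if b then 1 else -1) p := by
  unfold bern
  split_ifs
  · exact hasDerivAt_id p
  · simpa using (hasDerivAt_id p).const_sub 1

/-- With `t = p - 1/2`, the factor `3 (1/16 - t⁴)` equals `prior p * (p * (1 - p))`, and `p (1 - p)`
clears the denominators in the logarithmic derivative of `colWeight`. -/
lemma hasDerivAt_potential [DecidableEq ι] (c : ι → Bool) (p : ℝ) :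
    HasDerivAt (fun p => 3 * (1 / 16 - (p - 1 / 2) ^ 4) * colWeight p c)
      (prior p * (colWeight p c * (ones c - Fintype.card ι * p)) -
        12 * (p - 1 / 2) ^ 3 * colWeight p c) p := by
  have h1 : HasDerivAt (fun p : ℝ => 3 * (1 / 16 - (p - 1 / 2) ^ 4)) (-12 * (p - 1 / 2) ^ 3) p := by
    have := ((((hasDerivAt_id p).sub_const (1 / 2)).pow 4).const_sub (1 / 16)).const_mul 3
    refine this.congr_deriv ?_
    simp
    ring
  have h2 := HasDerivAt.fun_finsetProd (u := univ) (f := fun i p => bern p (c i))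
    fun i _ => hasDerivAt_bern p (c i)
  refine (h1.mul h2).congr_deriv ?_
  have h3 : p * (1 - p) * ∑ i, (∏ j ∈ univ.erase i, bern p (c j)) • (if c i then (1 : ℝ) else -1) =
      colWeight p c * (ones c - Fintype.card ι * p) := by
    have (i : ι) : p * (1 - p) *
        ((∏ j ∈ univ.erase i, bern p (c j)) • (if c i then (1 : ℝ) else -1)) =
        colWeight p c * (bit (c i) - p) := by
      rw [colWeight, ← mul_prod_erase univ _ (mem_univ i), smul_eq_mul]
      unfold bern bit
      split_ifs <;> ring
    rw [mul_sum, sum_congr rfl fun i _ => this i, ← mul_sum, sum_sub_distrib]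
    simp [ones]
  rw [← h3]
  unfold prior colWeight
  ring

/-- Integration by parts; the potential vanishes at both ends because of its factor `p (1 - p)`. -/
lemma integral_prior_mul_score [DecidableEq ι] (c : ι → Bool) :
    ∫ p in (0 : ℝ)..1, prior p * (colWeight p c * (ones c - Fintype.card ι * p)) =
      ∫ p in (0 : ℝ)..1, 12 * (p - 1 / 2) ^ 3 * colWeight p c := by
  have h := intervalIntegral.integral_eq_sub_of_hasDerivAt (a := 0) (b := 1)
    (fun p _ => hasDerivAt_potential c p) (Continuous.intervalIntegrable (by fun_prop) _ _)
  rw [intervalIntegral.integral_sub (Continuous.intervalIntegrable (by fun_prop) _ _)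
    (Continuous.intervalIntegrable (by fun_prop) _ _)] at h
  norm_num at h
  linarith

lemma integral_prior : ∫ p in (0 : ℝ)..1, prior p = 1 := by
  have h := intervalIntegral.integral_eq_sub_of_hasDerivAt (a := 0) (b := 1) (f := fun p : ℝ => 3 / 4 * p + (p - 1 / 2) ^ 3)
    (f' := prior) (fun p _ => by
      have := ((hasDerivAt_id p).const_mul (3 / 4)).add (((hasDerivAt_id p).sub_const (1 / 2)).pow 3)
      refine this.congr_deriv ?_
      simp [prior]
      ring) (Continuous.intervalIntegrable (by fun_prop) _ _)
  rw [h]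
  norm_num

/-- The positive value is what the choice of `prior` buys. For the uniform density the weight `12
t³` would become `2 t`, and the worst-case gain `∫ (2 t² - 2/3 |t|)` at error `1/3` would be zero.
-/
lemma integral_gain : ∫ p in (0 : ℝ)..1, (7 * (p - 1 / 2) ^ 4 - 4 / 5 * (p - 1 / 2) ^ 2) = 1 / 48 := by
  have h := intervalIntegral.integral_eq_sub_of_hasDerivAt (a := 0) (b := 1)
    (f := fun p : ℝ => 7 / 5 * (p - 1 / 2) ^ 5 - 4 / 15 * (p - 1 / 2) ^ 3)
    (f' := fun p : ℝ => 7 * (p - 1 / 2) ^ 4 - 4 / 5 * (p - 1 / 2) ^ 2) (fun p _ => by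
      have := ((((hasDerivAt_id p).sub_const (1 / 2)).pow 5).const_mul (7 / 5)).sub
        ((((hasDerivAt_id p).sub_const (1 / 2)).pow 3).const_mul (4 / 15))
      refine this.congr_deriv ?_
      simp
      ring) (Continuous.intervalIntegrable (by fun_prop) _ _)
  rw [h]
  norm_num

/-- The indicator that `a` is a good estimate of the mean of the column. -/
def accurate (a : ℝ) (μ : ℝ) : ℝ := if |μ - a| ≤ 1 / 3 then 1 else 0

lemma accurate_nonneg (a μ : ℝ) : 0 ≤ accurate a μ := by unfold accurate; split_ifs <;> norm_num

lemma accurate_le_one (a μ : ℝ) : accurate a μ ≤ 1 := by unfold accurate; split_ifs <;> norm_num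

lemma abs_clip_sub_le_accurate {a μ : ℝ} (h0 : 0 ≤ μ) (h1 : μ ≤ 1) :
    |clip a - μ| ≤ 1 / 3 + (1 - accurate a μ) := by
  unfold accurate
  split_ifs with h
  · linarith [abs_clip_sub_le (a := a) h0 h1]
  · rw [abs_le]; constructor <;> linarith [clip_nonneg a, clip_le_one a]

/-- The quadratic upper bound for one column's contribution. -/
lemma accurate_mul_exp_le {a μ lam M z : ℝ} (hz : |z| ≤ M / 2) (hlam : 0 ≤ lam) (hM : lam * M ≤ 1) :
    accurate a μ * Real.exp (-(lam * z)) ≤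
      1 + (lam * M) ^ 2 / 4 - lam * z - 1 / 2 * (1 - accurate a μ) := by
  have h1 : |lam * z| ≤ lam * M / 2 := by
    rw [abs_mul, abs_of_nonneg hlam]; nlinarith
  have h2 : (lam * z) ^ 2 ≤ (lam * M) ^ 2 / 4 := by
    have := pow_le_pow_left₀ (abs_nonneg _) h1 2
    rw [sq_abs] at this
    linarith
  have h3 := abs_le.1 h1
  unfold accurate
  split_ifs with h
  -- Accurate case: `exp x ≤ 1 + x + x²` for `|x| ≤ 1`.
  · have := (abs_le.1 (Real.abs_exp_sub_one_sub_id_le (x := -(lam * z))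
      (by rw [abs_neg]; linarith))).2
    nlinarith
  -- Inaccurate case: the left side is zero and `lam * z ≤ 1/2`, which leaves room for the penalty
  -- `1/2`.
  · nlinarith [sq_nonneg (lam * M)]

/-- The correlation of an estimate with the columns it was computed from, at a fixed mean `p`. -/
lemma cube_mul_sum_colWeight_ge {m : ℕ} [DecidableEq κ] {N : ℝ} (hN : N = m + Fintype.card κ) (hN0 : 0 < N)
    (a : (Fin m → Bool) → ℝ) {p : ℝ} (hp : p ∈ Set.Icc (0 : ℝ) 1) :
    7 * (p - 1 / 2) ^ 4 - 4 / 5 * (p - 1 / 2) ^ 2 - 2 * (prior p *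
      ∑ y : Fin m → Bool, ∑ u : κ → Bool, colWeight p y * colWeight p u *
        (1 - accurate (a y) ((ones y + ones u) / N))) ≤
    12 * (p - 1 / 2) ^ 3 * ∑ y : Fin m → Bool, colWeight p y * (clip (a y) - 1 / 2) := by
  set Q := ∑ y : Fin m → Bool, ∑ u : κ → Bool, colWeight p y * colWeight p u *
        (1 - accurate (a y) ((ones y + ones u) / N)) with hQ
  have hQ0 : 0 ≤ Q := sum_nonneg fun y _ => sum_nonneg fun u _ => mul_nonneg
    (mul_nonneg (colWeight_nonneg hp _) (colWeight_nonneg hp _)) (by linarith [accurate_le_one (a y) ((ones y + ones u) / N)])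
  have hone : ∑ y : Fin m → Bool, ∑ u : κ → Bool, colWeight p y * colWeight p u = 1 := by
    simp [← mul_sum, sum_colWeight]
  have hmean : ∑ y : Fin m → Bool, ∑ u : κ → Bool,
      colWeight p y * colWeight p u * ((ones y + ones u) / N) = p := by
    have h (y : Fin m → Bool) (u : κ → Bool) : colWeight p y * colWeight p u * ((ones y + ones u) / N) =
        (colWeight p y * ones y * colWeight p u + colWeight p y * (colWeight p u * ones u)) / N := by
      ring
    simp only [h, ← sum_div, sum_add_distrib, ← mul_sum, ← sum_mul, sum_colWeight, sum_colWeight_mul_ones]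
    rw [div_eq_iff hN0.ne', hN]
    simp
    ring
  have hclip : ∑ y : Fin m → Bool, colWeight p y * (clip (a y) - 1 / 2) =
      (p - 1 / 2) + ∑ y : Fin m → Bool, ∑ u : κ → Bool, colWeight p y * colWeight p u *
        (clip (a y) - (ones y + ones u) / N) := by
    have h (y : Fin m → Bool) (u : κ → Bool) : colWeight p y * colWeight p u * (clip (a y) - (ones y + ones u) / N) =
        colWeight p y * clip (a y) * colWeight p u - colWeight p y * colWeight p u * ((ones y + ones u) / N) := by
      ring
    simp only [h, sum_sub_distrib, hmean, ← mul_sum, sum_colWeight, mul_sub, mul_one, ← sum_mul]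
    ring
  set R := ∑ y : Fin m → Bool, ∑ u : κ → Bool, colWeight p y * colWeight p u *
        (clip (a y) - (ones y + ones u) / N) with hR
  have hRQ : |R| ≤ 1 / 3 + Q := by
    have : 1 / 3 + Q = ∑ y : Fin m → Bool, ∑ u : κ → Bool, colWeight p y * colWeight p u *
        (1 / 3 + (1 - accurate (a y) ((ones y + ones u) / N))) := by
      simp only [mul_add, sum_add_distrib, ← sum_mul, hone]
      rw [hQ, one_mul]
    rw [this]
    refine (abs_sum_le_sum_abs _ _).trans (sum_le_sum fun y _ => (abs_sum_le_sum_abs _ _).trans (sum_le_sum fun u _ => ?_))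
    have hw := mul_nonneg (colWeight_nonneg hp y) (colWeight_nonneg hp u)
    rw [abs_mul, abs_of_nonneg hw]
    refine mul_le_mul_of_nonneg_left (abs_clip_sub_le_accurate ?_ ?_) hw
    · exact div_nonneg (add_nonneg (ones_nonneg _) (ones_nonneg _)) hN0.le
    · rw [div_le_one hN0, hN]
      have := ones_le_card y
      rw [Fintype.card_fin] at this
      exact add_le_add this (ones_le_card u)
  rw [hclip]
  set t := p - 1 / 2 with ht
  have ht1 : |t| ≤ 1 / 2 := by rw [abs_le]; constructor <;> linarith [hp.1, hp.2]
  have hprior : prior p = 3 * (1 / 4 + t ^ 2) := rfl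
  rw [hprior]
  have hcube : |t ^ 3 * R| ≤ |t| ^ 3 * (1 / 3 + Q) := by
    rw [abs_mul, abs_pow]
    exact mul_le_mul_of_nonneg_left hRQ (by positivity)
  have h1 := (abs_le.1 hcube).1
  -- Arithmetic-geometric mean, to replace `|t|³` by a polynomial; equality holds at `|t| = 2/5`.
  have h2 : 4 * |t| ^ 3 ≤ 5 * t ^ 4 + 4 / 5 * t ^ 2 := by
    rw [← sq_abs t, show t ^ 4 = |t| ^ 4 by rw [← abs_pow, abs_of_nonneg (by positivity)]]
    nlinarith [mul_nonneg (sq_nonneg |t|) (sq_nonneg (5 * |t| - 2))]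
  have h3 : 12 * |t| ^ 3 ≤ 2 * (3 * (1 / 4 + t ^ 2)) := by
    have h5 : |t| ^ 3 ≤ (1 / 2) ^ 3 := pow_le_pow_left₀ (abs_nonneg _) ht1 3
    nlinarith [sq_nonneg t]
  nlinarith [mul_le_mul_of_nonneg_right h3 hQ0]

end Urn

end SecretSharing

namespace SecretSharing

open Finset MeasureTheory

/-! ### Exponential moment of one column -/

noncomputable section ColumnBound

/-- The probability of a column that starts with `y` together with a reference bit, weighted by
accuracy of the estimate `a` and exponentially by the score of the entries `y`. -/
def columnValue (m : ℕ) (κ : Type*) [Fintype κ] [DecidableEq κ] (lam a : ℝ) (y : Fin m → Bool) : ℝ :=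
  ∑ u : κ → Bool, ∑ b : Bool,
    (∫ p in (0 : ℝ)..1, prior p * (colWeight p y * colWeight p u) * bern p b) *
      (accurate a ((ones y + ones u) / (m + Fintype.card κ)) *
        Real.exp (-(lam * ((clip a - 1 / 2) * (ones y - m * bit b)))))

variable {m : ℕ} {κ : Type*} [Fintype κ]

lemma abs_score_le (a : ℝ) (y : Fin m → Bool) (b : Bool) :
    |(clip a - 1 / 2) * (ones y - m * bit b)| ≤ m / 2 := by
  have h1 : |ones y - m * bit b| ≤ m := by
    have h2 := ones_nonneg y
    have h3 := ones_le_card y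
    rw [Fintype.card_fin] at h3
    have h4 : 0 ≤ m * bit b := mul_nonneg (Nat.cast_nonneg _) (bit_nonneg _)
    have h5 : m * bit b ≤ m := mul_le_of_le_one_right (Nat.cast_nonneg _) (bit_le_one _)
    rw [abs_le]; constructor <;> linarith
  rw [abs_mul]
  calc _ ≤ 1 / 2 * (m : ℝ) := mul_le_mul (abs_clip_sub_half_le a) h1 (abs_nonneg _) (by norm_num)
    _ = m / 2 := by ring

lemma integral_weight_nonneg (y : Fin m → Bool) (u : κ → Bool) (b : Bool) :
    0 ≤ ∫ p in (0 : ℝ)..1, prior p * (colWeight p y * colWeight p u) * bern p b :=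
  intervalIntegral.integral_nonneg zero_le_one fun p hp =>
    mul_nonneg (mul_nonneg (prior_nonneg p)
      (mul_nonneg (colWeight_nonneg hp _) (colWeight_nonneg hp _))) (bern_nonneg hp _)

variable [DecidableEq κ]

lemma columnValue_nonneg (lam a : ℝ) (y : Fin m → Bool) : 0 ≤ columnValue m κ lam a y :=
  sum_nonneg fun u _ => sum_nonneg fun b _ => mul_nonneg (integral_weight_nonneg y u b)
    (mul_nonneg (accurate_nonneg _ _) (Real.exp_pos _).le)

lemma columnValue_eq_integral (lam a : ℝ) (y : Fin m → Bool) :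
    columnValue m κ lam a y = ∫ p in (0 : ℝ)..1, prior p * ∑ u : κ → Bool, ∑ b : Bool,
      colWeight p y * colWeight p u * bern p b *
      (accurate a ((ones y + ones u) / (m + Fintype.card κ)) *
        Real.exp (-(lam * ((clip a - 1 / 2) * (ones y - m * bit b))))) := by
  unfold columnValue
  simp only [mul_sum]
  rw [intervalIntegral.integral_finsetSum
    fun u _ => Continuous.intervalIntegrable (by fun_prop) _ _]
  refine sum_congr rfl fun u _ => ?_
  rw [intervalIntegral.integral_finsetSum
    fun u _ => Continuous.intervalIntegrable (by fun_prop) _ _]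
  refine sum_congr rfl fun b _ => ?_
  rw [← intervalIntegral.integral_mul_const]
  congr 1
  ext p
  ring

/-- Whatever estimates are computed from the first `m` entries of a random column, being accurate
forces a positive score. -/
lemma sum_columnValue_le {lam : ℝ} (h0 : 0 ≤ lam) (h1 : lam ≤ 1 / 4) (hm : 0 < m)
    (hlam : lam * m ≤ 1) (a : (Fin m → Bool) → ℝ) :
    ∑ y : Fin m → Bool, columnValue m κ lam (a y) y ≤ 1 - lam / 48 + (lam * m) ^ 2 / 4 := by
  set N : ℝ := m + Fintype.card κ with hN
  have hN0 : 0 < N := by positivity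
  set Q : ℝ → ℝ := fun p => ∑ y : Fin m → Bool, ∑ u : κ → Bool, colWeight p y * colWeight p u *
        (1 - accurate (a y) ((ones y + ones u) / N)) with hQ
  have hQc : Continuous Q := by rw [hQ]; fun_prop
  set A : ℝ → ℝ := fun p => ∑ y : Fin m → Bool,
    (clip (a y) - 1 / 2) * (prior p * (colWeight p y * (ones y - m * p))) with hA
  have hAc : Continuous A := by rw [hA]; fun_prop
  set B : ℝ → ℝ := fun p => ∑ y : Fin m → Bool,
    (clip (a y) - 1 / 2) * (12 * (p - 1 / 2) ^ 3 * colWeight p y) with hB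
  have hBc : Continuous B := by rw [hB]; fun_prop
  have hAB : ∫ p in (0 : ℝ)..1, A p = ∫ p in (0 : ℝ)..1, B p := by
    rw [hA, hB, intervalIntegral.integral_finsetSum
      fun u _ => Continuous.intervalIntegrable (by fun_prop) _ _,
      intervalIntegral.integral_finsetSum
      fun u _ => Continuous.intervalIntegrable (by fun_prop) _ _]
    refine sum_congr rfl fun y _ => ?_
    have := integral_prior_mul_score y
    rw [Fintype.card_fin] at this
    rw [intervalIntegral.integral_const_mul, intervalIntegral.integral_const_mul, this]
  set C : ℝ := 1 + (lam * m) ^ 2 / 4 with hC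
  have hpoint : ∀ p ∈ Set.Icc (0 : ℝ) 1,
      ∑ y : Fin m → Bool, (prior p * ∑ u : κ → Bool, ∑ b : Bool,
        colWeight p y * colWeight p u * bern p b * (accurate (a y) ((ones y + ones u) / N) *
          Real.exp (-(lam * ((clip (a y) - 1 / 2) * (ones y - m * bit b)))))) ≤
      C * prior p - lam * A p - 1 / 2 * (prior p * Q p) := by
    intro p hp
    have hb (y : Fin m → Bool) (u : κ → Bool) :
        ∑ b : Bool, colWeight p y * colWeight p u * bern p b *
          (accurate (a y) ((ones y + ones u) / N) *
          Real.exp (-(lam * ((clip (a y) - 1 / 2) * (ones y - m * bit b))))) ≤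
        colWeight p y * colWeight p u * (C - lam * ((clip (a y) - 1 / 2) * (ones y - m * p)) -
          1 / 2 * (1 - accurate (a y) ((ones y + ones u) / N))) := by
      have hw := mul_nonneg (colWeight_nonneg hp y) (colWeight_nonneg hp u)
      refine (sum_le_sum fun b _ => mul_le_mul_of_nonneg_left
        (accurate_mul_exp_le (abs_score_le (a y) y b) h0 hlam)
        (mul_nonneg hw (bern_nonneg hp b))).trans (le_of_eq ?_)
      -- The upper bound is affine in the reference bit, so averaging over it puts `p` in its place.
      simp only [Fintype.sum_bool, bern, bit, hC]
      simp only [if_true, Bool.false_eq_true, if_false]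
      ring
    calc _ ≤ ∑ y : Fin m → Bool, (prior p * ∑ u : κ → Bool,
        colWeight p y * colWeight p u * (C - lam * ((clip (a y) - 1 / 2) * (ones y - m * p)) -
          1 / 2 * (1 - accurate (a y) ((ones y + ones u) / N)))) :=
          sum_le_sum fun y _ => mul_le_mul_of_nonneg_left (sum_le_sum fun u _ => hb y u) (prior_nonneg p)
      _ = _ := by
        have hone : ∑ y : Fin m → Bool, ∑ u : κ → Bool, colWeight p y * colWeight p u = 1 := by
          simp [← mul_sum, sum_colWeight]
        have hA' : A p = prior p * ∑ y : Fin m → Bool, ∑ u : κ → Bool, colWeight p y * colWeight p u *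
            ((clip (a y) - 1 / 2) * (ones y - m * p)) := by
          simp only [hA, mul_sum]
          refine sum_congr rfl fun y _ => ?_
          have : ∑ u : κ → Bool, prior p * (colWeight p y * colWeight p u *
            ((clip (a y) - 1 / 2) * (ones y - m * p))) = ∑ u : κ → Bool, (prior p * (colWeight p y *
            ((clip (a y) - 1 / 2) * (ones y - m * p)))) * colWeight p u :=
              sum_congr rfl fun u _ => by ring
          rw [this, ← mul_sum, sum_colWeight]
          ring
        have hCp : C * prior p = prior p * ∑ y : Fin m → Bool, ∑ u : κ → Bool,
            C * (colWeight p y * colWeight p u) := by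
          simp only [← mul_sum, sum_colWeight, mul_one]
          ring
        rw [hA', hCp, hQ]
        simp only [mul_sum, ← sum_sub_distrib]
        refine sum_congr rfl fun y _ => sum_congr rfl fun u _ => ?_
        ring
  simp only [columnValue_eq_integral]
  rw [← intervalIntegral.integral_finsetSum
      fun u _ => Continuous.intervalIntegrable (by fun_prop) _ _]
  calc _ ≤ ∫ p in (0 : ℝ)..1, (C * prior p - lam * A p - 1 / 2 * (prior p * Q p)) :=
        intervalIntegral.integral_mono_on zero_le_one
          (Continuous.intervalIntegrable (by fun_prop) _ _)
          (Continuous.intervalIntegrable (by fun_prop) _ _) hpoint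
    _ = ∫ p in (0 : ℝ)..1, (C * prior p - lam * B p - 1 / 2 * (prior p * Q p)) := by
        rw [intervalIntegral.integral_sub (Continuous.intervalIntegrable (by fun_prop) _ _)
          (Continuous.intervalIntegrable (by fun_prop) _ _),
          intervalIntegral.integral_sub (Continuous.intervalIntegrable (by fun_prop) _ _)
          (Continuous.intervalIntegrable (by fun_prop) _ _),
          intervalIntegral.integral_sub (Continuous.intervalIntegrable (by fun_prop) _ _)
          (Continuous.intervalIntegrable (by fun_prop) _ _),
          intervalIntegral.integral_sub (Continuous.intervalIntegrable (by fun_prop) _ _)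
          (Continuous.intervalIntegrable (by fun_prop) _ _)]
        simp only [intervalIntegral.integral_const_mul, hAB]
    _ ≤ ∫ p in (0 : ℝ)..1, (C * prior p -
          lam * (7 * (p - 1 / 2) ^ 4 - 4 / 5 * (p - 1 / 2) ^ 2)) := by
        refine intervalIntegral.integral_mono_on zero_le_one
          (Continuous.intervalIntegrable (by fun_prop) _ _)
          (Continuous.intervalIntegrable (by fun_prop) _ _) fun p hp => ?_
        have h := cube_mul_sum_colWeight_ge (κ := κ) hN hN0 a hp
        have hBp : B p = 12 * (p - 1 / 2) ^ 3 *
            ∑ y : Fin m → Bool, colWeight p y * (clip (a y) - 1 / 2) := by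
          simp only [hB, mul_sum]
          exact sum_congr rfl fun y _ => by ring
        have hQ0 : 0 ≤ prior p * Q p := mul_nonneg (prior_nonneg p) <|
          sum_nonneg fun y _ => sum_nonneg fun u _ => mul_nonneg
            (mul_nonneg (colWeight_nonneg hp _) (colWeight_nonneg hp _))
            (by linarith [accurate_le_one (a y) ((ones y + ones u) / N)])
        rw [← hBp] at h
        -- Inaccuracy costs `2 * lam * prior p * Q p` in the correlation; since `lam ≤ 1/4`, the
        -- penalty `1/2 * (prior p * Q p)` covers it.
        have h' := mul_le_mul_of_nonneg_left h h0
        change lam * (_ - 2 * (prior p * Q p)) ≤ _ at h'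
        nlinarith
    _ = 1 - lam / 48 + (lam * m) ^ 2 / 4 := by
        rw [intervalIntegral.integral_sub (Continuous.intervalIntegrable (by fun_prop) _ _)
          (Continuous.intervalIntegrable (by fun_prop) _ _), intervalIntegral.integral_const_mul,
          intervalIntegral.integral_const_mul, integral_prior, integral_gain, hC]
        ring

/-- The value of the best estimate. -/
def bestValue (m : ℕ) (κ : Type*) [Fintype κ] [DecidableEq κ] (lam : ℝ) (y : Fin m → Bool) : ℝ :=
  ⨆ a, columnValue m κ lam a y

lemma bddAbove_columnValue {lam : ℝ} (h0 : 0 ≤ lam) (y : Fin m → Bool) :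
    BddAbove (Set.range fun a => columnValue m κ lam a y) := by
  refine ⟨∑ u : κ → Bool, ∑ b : Bool,
    (∫ p in (0 : ℝ)..1, prior p * (colWeight p y * colWeight p u) * bern p b) *
      (1 * Real.exp (lam * (m / 2))), ?_⟩
  rintro _ ⟨a, rfl⟩
  refine sum_le_sum fun u _ => sum_le_sum fun b _ => mul_le_mul_of_nonneg_left
    (mul_le_mul (accurate_le_one _ _) (Real.exp_le_exp.2 ?_) (Real.exp_pos _).le zero_le_one)
    (integral_weight_nonneg y u b)
  rw [← mul_neg]
  exact mul_le_mul_of_nonneg_left (by linarith [(abs_le.1 (abs_score_le a y b)).1]) h0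

lemma columnValue_le_bestValue {lam : ℝ} (h0 : 0 ≤ lam) (a : ℝ) (y : Fin m → Bool) :
    columnValue m κ lam a y ≤ bestValue m κ lam y :=
  le_ciSup (bddAbove_columnValue h0 y) a

lemma bestValue_nonneg {lam : ℝ} (h0 : 0 ≤ lam) (y : Fin m → Bool) : 0 ≤ bestValue m κ lam y :=
  (columnValue_nonneg lam 0 y).trans (columnValue_le_bestValue h0 0 y)

/-- The best estimate depends on the column `y` alone, so `sum_columnValue_le` applies to
near-maximisers; the slack `η` is needed because the supremum may not be attained. -/
lemma sum_bestValue_le {lam : ℝ} (h0 : 0 ≤ lam) (h1 : lam ≤ 1 / 4) (hm : 0 < m)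
    (hlam : lam * m ≤ 1) :
    ∑ y : Fin m → Bool, bestValue m κ lam y ≤ 1 - lam / 48 + (lam * m) ^ 2 / 4 := by
  refine le_of_forall_pos_le_add fun η hη => ?_
  have hc : (0 : ℝ) < Fintype.card (Fin m → Bool) := by exact_mod_cast Fintype.card_pos
  have h (y : Fin m → Bool) : ∃ a, bestValue m κ lam y - η / Fintype.card (Fin m → Bool) < columnValue m κ lam a y :=
    exists_lt_of_lt_ciSup (sub_lt_self _ (div_pos hη hc))
  choose a ha using h
  have h2 := sum_le_sum fun y (_ : y ∈ univ) => (ha y).le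
  rw [sum_sub_distrib, sum_const, card_univ, nsmul_eq_mul, mul_div_cancel₀ _ hc.ne'] at h2
  linarith [sum_columnValue_le (κ := κ) h0 h1 hm hlam a]

end ColumnBound

end SecretSharing

namespace SecretSharing

open Finset MeasureTheory

/-! ### Random datasets, reference rows and scores -/

noncomputable section Rows

variable {ι : Type*} [Fintype ι] {d : ℕ}

lemma sum_prod_column [DecidableEq ι] (g : Fin d → (ι → Bool) → ℝ) :
    ∑ Y : ι → Fin d → Bool, ∏ j, g j (fun l => Y l j) = ∏ j, ∑ y, g j y := by
  have h := prod_univ_sum (fun _ : Fin d => (univ : Finset (ι → Bool))) g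
  rw [Fintype.piFinset_univ] at h
  rw [h]
  exact Fintype.sum_equiv (Equiv.piComm _) _ _ fun _ => rfl

lemma sum_prod_row (g : Fin d → Bool → ℝ) :
    ∑ x : Fin d → Bool, ∏ j, g j (x j) = ∏ j, ∑ b, g j b := by
  have h := prod_univ_sum (fun _ : Fin d => (univ : Finset Bool)) g
  rw [Fintype.piFinset_univ] at h
  exact h.symm

lemma sum_sum_prod_column [DecidableEq ι] (g : Fin d → (ι → Bool) → Bool → ℝ) :
    ∑ Y : ι → Fin d → Bool, ∑ x : Fin d → Bool, ∏ j, g j (fun l => Y l j) (x j) =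
      ∏ j, ∑ y, ∑ b, g j y b := by
  rw [← sum_prod_column]
  exact sum_congr rfl fun Y _ => sum_prod_row fun j b => g j (fun l => Y l j) b

/-- The probability of a column. -/
def urn (c : ι → Bool) : ℝ := ∫ p in (0 : ℝ)..1, prior p * colWeight p c

/-- The probability of a column with one reference bit. -/
def urnOne (c : ι → Bool) (b : Bool) : ℝ := ∫ p in (0 : ℝ)..1, prior p * colWeight p c * bern p b

/-- The probability of a column with two reference bits. -/
def urnTwo (c : ι → Bool) (b b' : Bool) : ℝ :=
  ∫ p in (0 : ℝ)..1, prior p * colWeight p c * bern p b * bern p b'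

lemma urnOne_nonneg (c : ι → Bool) (b : Bool) : 0 ≤ urnOne c b :=
  intervalIntegral.integral_nonneg zero_le_one fun p hp =>
    mul_nonneg (mul_nonneg (prior_nonneg p) (colWeight_nonneg hp _)) (bern_nonneg hp _)

lemma urnTwo_nonneg (c : ι → Bool) (b b' : Bool) : 0 ≤ urnTwo c b b' :=
  intervalIntegral.integral_nonneg zero_le_one fun p hp =>
    mul_nonneg (mul_nonneg (mul_nonneg (prior_nonneg p) (colWeight_nonneg hp _))
      (bern_nonneg hp _)) (bern_nonneg hp _)

lemma sum_urnTwo (c : ι → Bool) (b : Bool) : ∑ b', urnTwo c b b' = urnOne c b := by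
  unfold urnTwo urnOne
  rw [← intervalIntegral.integral_finsetSum
    fun _ _ => Continuous.intervalIntegrable (by fun_prop) _ _]
  congr 1
  ext p
  rw [← mul_sum, sum_bern, mul_one]

lemma sum_urnOne (c : ι → Bool) : ∑ b, urnOne c b = urn c := by
  unfold urn urnOne
  rw [← intervalIntegral.integral_finsetSum
    fun _ _ => Continuous.intervalIntegrable (by fun_prop) _ _]
  congr 1
  ext p
  rw [← mul_sum, sum_bern, mul_one]

lemma sum_urn [DecidableEq ι] : ∑ c : ι → Bool, urn c = 1 := by
  unfold urn
  rw [← intervalIntegral.integral_finsetSum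
    fun _ _ => Continuous.intervalIntegrable (by fun_prop) _ _]
  simp only [← mul_sum, sum_colWeight, mul_one, integral_prior]

lemma urn_nonneg (c : ι → Bool) : 0 ≤ urn c :=
  intervalIntegral.integral_nonneg zero_le_one fun p hp =>
    mul_nonneg (prior_nonneg p) (colWeight_nonneg hp _)

lemma urnTwo_comm (c : ι → Bool) (b b' : Bool) : urnTwo c b b' = urnTwo c b' b := by
  unfold urnTwo
  congr 1
  ext p
  ring

/-- Given `p`, the entries and the reference bits are independent with the same law, so any of them
may be exchanged. -/
lemma urnTwo_update [DecidableEq ι] (c : ι → Bool) (i : ι) (b b' : Bool) :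
    urnTwo (Function.update c i b') b (c i) = urnTwo c b b' := by
  unfold urnTwo
  congr 1
  ext p
  have h (c : ι → Bool) : colWeight p c = bern p (c i) * ∏ l ∈ univ.erase i, bern p (c l) :=
    (mul_prod_erase univ (fun l => bern p (c l)) (mem_univ i)).symm
  rw [h, h c, Function.update_self]
  have h' : ∏ l ∈ univ.erase i, bern p (Function.update c i b' l) =
      ∏ l ∈ univ.erase i, bern p (c l) :=
    prod_congr rfl fun l hl => by rw [Function.update_of_ne (ne_of_mem_erase hl)]
  rw [h']
  ring

/-- The two reference bits are exchangeable, so the unequal pairs combine to a `cosh`. The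
difference is thus centred without knowledge of `p`. -/
lemma sum_urnTwo_mul_exp_le (c : ι → Bool) {θ α : ℝ} (hα : |α| ≤ 1 / 2) :
    ∑ b, ∑ b', urnTwo c b b' * Real.exp (θ * (α * (bit b' - bit b))) ≤
      urn c * Real.exp (θ ^ 2 / 8) := by
  have hcosh : Real.cosh (θ * α) ≤ Real.exp (θ ^ 2 / 8) := by
    refine (Real.cosh_le_exp_half_sq _).trans (Real.exp_le_exp.2 ?_)
    have : α ^ 2 ≤ 1 / 4 := by
      rw [← sq_abs]
      nlinarith [abs_nonneg α]
    nlinarith [sq_nonneg θ]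
  have hone : 1 ≤ Real.exp (θ ^ 2 / 8) := Real.one_le_exp (by positivity)
  rw [← sum_urnOne]
  simp only [← sum_urnTwo]
  simp only [Fintype.sum_bool, bit, if_true, Bool.false_eq_true, if_false]
  rw [urnTwo_comm c false true]
  rw [Real.cosh_eq] at hcosh
  have h1 := mul_le_mul_of_nonneg_left hcosh (urnTwo_nonneg c true false)
  have h2 := mul_le_mul_of_nonneg_left hone (urnTwo_nonneg c true true)
  have h3 := mul_le_mul_of_nonneg_left hone (urnTwo_nonneg c false false)
  simp only [sub_self, mul_zero, Real.exp_zero, mul_one, zero_sub, sub_zero, mul_neg] at *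
  linarith

/-- The probability of a dataset. -/
def dataWeight (D : ι → Fin d → Bool) : ℝ := ∏ j, urn fun i => D i j

/-- The probability of a dataset with one reference row. -/
def dataWeightOne (D : ι → Fin d → Bool) (x : Fin d → Bool) : ℝ :=
  ∏ j, urnOne (fun i => D i j) (x j)

/-- The probability of a dataset with two reference rows. -/
def dataWeightTwo (D : ι → Fin d → Bool) (x x' : Fin d → Bool) : ℝ :=
  ∏ j, urnTwo (fun i => D i j) (x j) (x' j)

/-- The correlation of the estimates `a` with the row `x`, relative to the reference row `x'`. -/
def score (a : Fin d → ℝ) (x x' : Fin d → Bool) : ℝ :=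
  ∑ j, (clip (a j) - 1 / 2) * (bit (x j) - bit (x' j))

lemma dataWeightOne_nonneg (D : ι → Fin d → Bool) (x : Fin d → Bool) : 0 ≤ dataWeightOne D x :=
  prod_nonneg fun _ _ => urnOne_nonneg ..

lemma dataWeightTwo_nonneg (D : ι → Fin d → Bool) (x x' : Fin d → Bool) :
    0 ≤ dataWeightTwo D x x' :=
  prod_nonneg fun _ _ => urnTwo_nonneg ..

lemma sum_dataWeightTwo (D : ι → Fin d → Bool) (x : Fin d → Bool) :
    ∑ x', dataWeightTwo D x x' = dataWeightOne D x := by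
  unfold dataWeightTwo dataWeightOne
  rw [sum_prod_row fun j b => urnTwo (fun i => D i j) (x j) b]
  simp only [sum_urnTwo]

lemma sum_dataWeightOne (D : ι → Fin d → Bool) : ∑ x, dataWeightOne D x = dataWeight D := by
  unfold dataWeightOne dataWeight
  rw [sum_prod_row fun j b => urnOne (fun i => D i j) b]
  simp only [sum_urnOne]

lemma sum_dataWeight [DecidableEq ι] : ∑ D : ι → Fin d → Bool, dataWeight D = 1 := by
  unfold dataWeight
  rw [sum_prod_column fun _ => urn]
  simp [sum_urn]

lemma dataWeightTwo_update [DecidableEq ι] (D : ι → Fin d → Bool) (i : ι) (x x' : Fin d → Bool) :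
    dataWeightTwo (Function.update D i x') x (D i) = dataWeightTwo D x x' := by
  unfold dataWeightTwo
  refine prod_congr rfl fun j _ => ?_
  rw [← urnTwo_update (fun l => D l j) i]
  congr 1
  ext l
  by_cases h : l = i
  · subst h; simp
  · simp [Function.update_of_ne h]

/-- A row that the estimates do not depend on has a small score. -/
lemma sum_dataWeightTwo_score_le (D : ι → Fin d → Bool) (a : Fin d → ℝ) {t : ℝ} (ht : 0 ≤ t)
    (hd : 0 < d) :
    ∑ x, ∑ x', dataWeightTwo D x x' * (if t < score a x' x then 1 else 0) ≤
      dataWeight D * Real.exp (-(2 * t ^ 2 / d)) := by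
  have hd' : (0 : ℝ) < d := by exact_mod_cast hd
  -- Chernoff bound; this `θ` minimises `-θ t + d θ² / 8`.
  set θ : ℝ := 4 * t / d with hθ
  have hθ0 : 0 ≤ θ := by positivity
  have h1 (x x' : Fin d → Bool) : dataWeightTwo D x x' * (if t < score a x' x then 1 else 0) ≤
      Real.exp (-(θ * t)) * ∏ j, urnTwo (fun i => D i j) (x j) (x' j) *
        Real.exp (θ * ((clip (a j) - 1 / 2) * (bit (x' j) - bit (x j)))) := by
    rw [prod_mul_distrib, ← Real.exp_sum, ← mul_sum, mul_left_comm, ← Real.exp_add]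
    refine mul_le_mul_of_nonneg_left ?_ (dataWeightTwo_nonneg D x x')
    split_ifs with h
    · refine Real.one_le_exp ?_
      unfold score at h
      nlinarith
    · exact (Real.exp_pos _).le
  have h2 : ∑ x : Fin d → Bool, ∑ x' : Fin d → Bool, ∏ j, urnTwo (fun i => D i j) (x j) (x' j) *
        Real.exp (θ * ((clip (a j) - 1 / 2) * (bit (x' j) - bit (x j)))) =
      ∏ j, ∑ b, ∑ b', urnTwo (fun i => D i j) b b' *
        Real.exp (θ * ((clip (a j) - 1 / 2) * (bit b' - bit b))) := by
    rw [← sum_prod_row]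
    refine sum_congr rfl fun x _ => ?_
    rw [sum_prod_row fun j b' => urnTwo (fun i => D i j) (x j) b' *
        Real.exp (θ * ((clip (a j) - 1 / 2) * (bit b' - bit (x j))))]
  calc _ ≤ _ := sum_le_sum fun x _ => sum_le_sum fun x' _ => h1 x x'
    _ = Real.exp (-(θ * t)) * ∏ j, ∑ b, ∑ b', urnTwo (fun i => D i j) b b' *
        Real.exp (θ * ((clip (a j) - 1 / 2) * (bit b' - bit b))) := by
      simp only [← mul_sum, h2]
    _ ≤ Real.exp (-(θ * t)) * ∏ j, (urn (fun i => D i j) * Real.exp (θ ^ 2 / 8)) := by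
      refine mul_le_mul_of_nonneg_left (prod_le_prod (fun j _ => ?_) fun j _ => ?_) (Real.exp_pos _).le
      · exact sum_nonneg fun _ _ => sum_nonneg fun _ _ => mul_nonneg (urnTwo_nonneg ..) (Real.exp_pos _).le
      · exact sum_urnTwo_mul_exp_le _ (abs_clip_sub_half_le _)
    _ = dataWeight D * Real.exp (-(2 * t ^ 2 / d)) := by
      rw [prod_mul_distrib, prod_const, card_univ, Fintype.card_fin, ← Real.exp_nat_mul,
        mul_left_comm, ← Real.exp_add, dataWeight]
      congr 2
      rw [hθ]
      field_simp
      ring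

lemma urnOne_elim {κ : Type*} [Fintype κ] {m : ℕ} (e : ι ≃ Fin m ⊕ κ) (y : Fin m → Bool) (u : κ → Bool) (b : Bool) :
    urnOne (Sum.elim y u ∘ e) b =
      ∫ p in (0 : ℝ)..1, prior p * (colWeight p y * colWeight p u) * bern p b := by
  unfold urnOne
  simp only [colWeight_comp, colWeight_elim]

/-- The event that all estimates are accurate but no row stands out. -/
def Undetected {n : ℕ} (D : Dataset n d) (x : Fin d → Bool) (t : ℝ) (a : Fin d → ℝ) : Prop :=
  (∀ j, |marginal D j - a j| ≤ 1 / 3) ∧ ∀ i, score a (D i) x ≤ t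

open Classical in
/-- Having seen only the rows `Y`, one rarely gives accurate estimates with no row standing out. -/
lemma sum_dataWeightOne_undetected_le {n m : ℕ} {κ : Type*} [Fintype κ] [DecidableEq κ]
    (hn : n = m + Fintype.card κ) {lam t : ℝ} (h0 : 0 ≤ lam) (a : Fin d → ℝ)
    (e : Fin n ≃ Fin m ⊕ κ) (Y : Fin m → Fin d → Bool) :
    ∑ U : κ → Fin d → Bool, ∑ x, dataWeightOne (Sum.elim Y U ∘ e) x *
        (if Undetected (Sum.elim Y U ∘ e) x t a then 1 else 0) ≤
      Real.exp (lam * (m * t)) * ∏ j, bestValue m κ lam fun l => Y l j := by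
  have hcol (U : κ → Fin d → Bool) (j : Fin d) :
      (fun i => (Sum.elim Y U ∘ e) i j) = Sum.elim (fun l => Y l j) (fun l => U l j) ∘ e := by
    ext i
    simp only [Function.comp_apply]
    rcases e i with l | l <;> rfl
  have hmarg (U : κ → Fin d → Bool) (j : Fin d) : marginal (Sum.elim Y U ∘ e : Dataset n d) j =
      (ones (fun l => Y l j) + ones fun l => U l j) / (m + Fintype.card κ) := by
    have hn' : (n : ℝ) = m + Fintype.card κ := by exact_mod_cast hn
    rw [← ones_elim, ← ones_comp e, ← hcol, marginal, hn']
    rfl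
  have h1 (U : κ → Fin d → Bool) (x : Fin d → Bool) :
      dataWeightOne (Sum.elim Y U ∘ e) x *
        (if Undetected (Sum.elim Y U ∘ e) x t a then 1 else 0) ≤
      Real.exp (lam * (m * t)) * ∏ j,
        (∫ p in (0 : ℝ)..1, prior p * (colWeight p (fun l => Y l j) * colWeight p (fun l => U l j)) * bern p (x j)) *
      (accurate (a j) ((ones (fun l => Y l j) + ones fun l => U l j) / (m + Fintype.card κ)) *
        Real.exp (-(lam * ((clip (a j) - 1 / 2) * (ones (fun l => Y l j) - m * bit (x j)))))) := by
    have hw : dataWeightOne (Sum.elim Y U ∘ e) x = ∏ j,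
        (∫ p in (0 : ℝ)..1, prior p * (colWeight p (fun l => Y l j) * colWeight p (fun l => U l j)) * bern p (x j)) := by
      unfold dataWeightOne
      simp only [hcol, urnOne_elim]
    rw [prod_mul_distrib, ← hw, mul_left_comm]
    refine mul_le_mul_of_nonneg_left ?_ (dataWeightOne_nonneg _ _)
    split_ifs with h
    · have hacc : ∏ j, (accurate (a j) ((ones (fun l => Y l j) + ones fun l => U l j) / (m + Fintype.card κ)) *
        Real.exp (-(lam * ((clip (a j) - 1 / 2) * (ones (fun l => Y l j) - m * bit (x j)))))) =
          ∏ j, Real.exp (-(lam * ((clip (a j) - 1 / 2) * (ones (fun l => Y l j) - m * bit (x j))))) := by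
        refine prod_congr rfl fun j _ => ?_
        have := h.1 j
        rw [hmarg] at this
        rw [accurate, if_pos this, one_mul]
      rw [hacc, ← Real.exp_sum, ← Real.exp_add]
      refine Real.one_le_exp ?_
      have hs : ∑ l : Fin m, score a (Y l) x =
          ∑ j, (clip (a j) - 1 / 2) * (ones (fun l => Y l j) - m * bit (x j)) := by
        unfold score
        rw [sum_comm]
        refine sum_congr rfl fun j _ => ?_
        rw [← mul_sum, sum_sub_distrib]
        simp [ones]
      -- Only the scores of the `m` visible rows are used.
      have ht : ∑ l : Fin m, score a (Y l) x ≤ m * t := by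
        calc _ ≤ ∑ _l : Fin m, t := sum_le_sum fun l _ => by
              simpa using h.2 (e.symm (Sum.inl l))
          _ = m * t := by simp
      rw [sum_neg_distrib, ← mul_sum, ← hs]
      nlinarith
    · exact mul_nonneg (Real.exp_pos _).le (prod_nonneg fun j _ =>
        mul_nonneg (accurate_nonneg _ _) (Real.exp_pos _).le)
  calc _ ≤ _ := sum_le_sum fun U _ => sum_le_sum fun x _ => h1 U x
    _ = Real.exp (lam * (m * t)) * ∏ j, columnValue m κ lam (a j) fun l => Y l j := by
      simp only [← mul_sum]
      rw [sum_sum_prod_column fun j u b =>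
        (∫ p in (0 : ℝ)..1, prior p * (colWeight p (fun l => Y l j) * colWeight p u) * bern p b) *
        (accurate (a j) ((ones (fun l => Y l j) + ones u) / (m + Fintype.card κ)) *
        Real.exp (-(lam * ((clip (a j) - 1 / 2) * (ones (fun l => Y l j) - m * bit b)))))]
      rfl
    _ ≤ _ := mul_le_mul_of_nonneg_left (prod_le_prod (fun j _ => columnValue_nonneg _ _ _)
        fun j _ => columnValue_le_bestValue h0 _ _) (Real.exp_pos _).le

end Rows

end SecretSharing

namespace SecretSharing

open Finset MeasureTheory

/-! ### The output law as an average over seeds -/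

section Law

variable {n d : ℕ} {F : Type v} [Field F] [Fintype F]

lemma nonempty_rowSeed (hF : 4 * d < Fintype.card F) : Nonempty (RowSeed F d) := by
  have h : Nonempty (Fin (3 * d) ↪ F) := Function.Embedding.nonempty_of_card_le (by simp; omega)
  exact ⟨h.some, 0⟩

lemma card_rowSeed_pos (hF : 4 * d < Fintype.card F) :
    0 < Fintype.card (Fin n → RowSeed F d) := by
  have := nonempty_rowSeed hF
  exact Fintype.card_pos

variable [DecidableEq F]

lemma outputLaw_real (A : Algorithm.{u} n d F) (D : Dataset n d) {E : Set (Fin d → ℝ)}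
    (hE : MeasurableSet E) :
    letI := A.measurableSpaceCoins
    (outputLaw A D).real E = (Fintype.card (Fin n → RowSeed F d) : ℝ)⁻¹ *
      ∑ ρ : Fin n → RowSeed F d, A.coinLaw.real {ω | (A.tree ω).run (shareOracle D ρ) ∈ E} := by
  let _ := A.measurableSpaceCoins
  have := A.isProbabilityMeasure
  simp only [outputLaw, Measure.real, Measure.smul_apply, Measure.finsetSum_apply, smul_eq_mul,
    ENNReal.toReal_mul, ENNReal.toReal_inv, ENNReal.toReal_natCast]
  rw [ENNReal.toReal_sum fun ρ _ => by
    rw [Measure.map_apply (A.measurable_run _) hE]; exact measure_ne_top _ _]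
  congr 1
  refine sum_congr rfl fun ρ _ => ?_
  rw [Measure.map_apply (A.measurable_run _) hE]
  rfl

lemma isProbabilityMeasure_outputLaw (hF : 4 * d < Fintype.card F) (A : Algorithm.{u} n d F)
    (D : Dataset n d) : IsProbabilityMeasure (outputLaw A D) := by
  let _ := A.measurableSpaceCoins
  have := A.isProbabilityMeasure
  have h (ρ : Fin n → RowSeed F d) :
      (A.coinLaw.map fun ω => (A.tree ω).run (shareOracle D ρ)) Set.univ = 1 := by
    rw [Measure.map_apply (A.measurable_run _) MeasurableSet.univ]
    simp
  have hc := card_rowSeed_pos (n := n) hF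
  constructor
  simp only [outputLaw, Measure.smul_apply, Measure.finsetSum_apply, smul_eq_mul, h, sum_const,
    card_univ, nsmul_eq_mul, mul_one]
  exact ENNReal.inv_mul_cancel (by exact_mod_cast hc.ne') (ENNReal.natCast_ne_top _)

end Law

/-! ### Privacy against accuracy -/

section Attack

variable {n d : ℕ}

lemma measurable_score (x x' : Fin d → Bool) : Measurable fun a => score a x x' := by
  unfold score
  have := measurable_clip
  fun_prop

lemma measurableSet_lt_score (x x' : Fin d → Bool) (t : ℝ) : MeasurableSet {a | t < score a x x'} :=
  measurableSet_lt measurable_const (measurable_score x x')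

lemma measurableSet_undetected (D : Dataset n d) (x : Fin d → Bool) (t : ℝ) :
    MeasurableSet {a | Undetected D x t a} := by
  have h : {a | Undetected D x t a} =
      (⋂ j, {a : Fin d → ℝ | |marginal D j - a j| ≤ 1 / 3}) ∩ ⋂ i, {a | score a (D i) x ≤ t} := by
    ext a
    simp [Undetected]
  rw [h]
  exact (MeasurableSet.iInter fun j => measurableSet_le (by fun_prop) measurable_const).inter
    (MeasurableSet.iInter fun i => measurableSet_le (measurable_score _ _) measurable_const)

open Classical in
lemma real_setOf_eq_integral {Ω : Type*} [MeasurableSpace Ω] (μ : Measure Ω) [IsFiniteMeasure μ]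
    {P : Ω → Prop} (hP : MeasurableSet {ω | P ω}) :
    μ.real {ω | P ω} = ∫ ω, (if P ω then 1 else 0) ∂μ := by
  rw [← integral_indicator_one hP]
  rfl

open Classical in
lemma integrable_ite {Ω : Type*} [MeasurableSpace Ω] (μ : Measure Ω) [IsFiniteMeasure μ]
    {P : Ω → Prop} (hP : MeasurableSet {ω | P ω}) :
    Integrable (fun ω => if P ω then (1 : ℝ) else 0) μ :=
  (integrable_const (1 : ℝ)).indicator hP

/-- The output is drawn from the dataset alone, independently of both reference rows, so the tail
bound for fixed estimates can be integrated. -/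
lemma sum_score_law_le (M : Measure (Fin d → ℝ)) [IsProbabilityMeasure M] (D : Dataset n d)
    {t : ℝ} (ht : 0 ≤ t) (hd : 0 < d) :
    ∑ x, ∑ x', dataWeightTwo D x x' * M.real {a | t < score a x' x} ≤
      dataWeight D * Real.exp (-(2 * t ^ 2 / d)) := by
  classical
  have hi (x x' : Fin d → Bool) : Integrable
      (fun a => dataWeightTwo D x x' * if t < score a x' x then (1 : ℝ) else 0) M :=
    (integrable_ite M (measurableSet_lt_score x' x t)).const_mul _
  calc _ = ∫ a, ∑ x, ∑ x', dataWeightTwo D x x' * (if t < score a x' x then 1 else 0) ∂M := by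
        rw [integral_finsetSum _ fun x _ => integrable_finsetSum _ fun x' _ => hi x x']
        refine sum_congr rfl fun x _ => ?_
        rw [integral_finsetSum _ fun x' _ => hi x x']
        refine sum_congr rfl fun x' _ => ?_
        rw [integral_const_mul, real_setOf_eq_integral M (measurableSet_lt_score x' x t)]
    _ ≤ ∫ _a, dataWeight D * Real.exp (-(2 * t ^ 2 / d)) ∂M := by
        refine integral_mono (integrable_finsetSum _ fun x _ => integrable_finsetSum _ fun x' _ => hi x x')
          (integrable_const _) fun a => ?_
        exact sum_dataWeightTwo_score_le D a ht hd
    _ = _ := by simp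

/-- The substitution that exchanges the row `i` of the dataset with a separate row. -/
def swapRow (i : Fin n) : Dataset n d × (Fin d → Bool) ≃ Dataset n d × (Fin d → Bool) where
  toFun p := (Function.update p.1 i p.2, p.1 i)
  invFun p := (Function.update p.1 i p.2, p.1 i)
  left_inv p := by simp
  right_inv p := by simp

/-- In a differentially private mechanism, no fixed row stands out. -/
lemma sum_row_score_le {M : Dataset n d → Measure (Fin d → ℝ)} (hM : ∀ D, IsProbabilityMeasure (M D))
    {ε δ t : ℝ} (hDP : IsDP M ε δ) (ht : 0 ≤ t) (hd : 0 < d) (i : Fin n) :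
    ∑ D : Dataset n d, ∑ x, dataWeightOne D x * (M D).real {a | t < score a (D i) x} ≤
      Real.exp ε * Real.exp (-(2 * t ^ 2 / d)) + δ := by
  have htot : ∑ D : Dataset n d, ∑ x, ∑ x', dataWeightTwo D x x' = 1 := by
    simp only [sum_dataWeightTwo, sum_dataWeightOne, sum_dataWeight]
  -- Exchanging row `i` with `x'` turns the score of a row removed from the input into the score of
  -- a row that was never in it.
  have hswap : ∑ D : Dataset n d, ∑ x, ∑ x', dataWeightTwo D x x' *
        (M (Function.update D i x')).real {a | t < score a (D i) x} =
      ∑ D : Dataset n d, ∑ x, ∑ x', dataWeightTwo D x x' * (M D).real {a | t < score a x' x} := by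
    rw [sum_comm, sum_comm (s := (univ : Finset (Dataset n d)))]
    refine sum_congr rfl fun x _ => ?_
    rw [← Fintype.sum_prod_type', ← Fintype.sum_prod_type']
    refine Fintype.sum_equiv (swapRow i) _ _ fun p => ?_
    simp only [swapRow, Equiv.coe_fn_mk, dataWeightTwo_update]
  calc _ = ∑ D : Dataset n d, ∑ x, ∑ x', dataWeightTwo D x x' *
        (M D).real {a | t < score a (D i) x} := by
        simp only [← sum_dataWeightTwo, sum_mul]
    _ ≤ ∑ D : Dataset n d, ∑ x, ∑ x', dataWeightTwo D x x' *
        (Real.exp ε * (M (Function.update D i x')).real {a | t < score a (D i) x} + δ) := by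
        refine sum_le_sum fun D _ => sum_le_sum fun x _ => sum_le_sum fun x' _ =>
          mul_le_mul_of_nonneg_left (hDP D _ ⟨i, fun j hj => ?_⟩ _ (measurableSet_lt_score _ _ _))
            (dataWeightTwo_nonneg _ _ _)
        rw [Function.update_of_ne hj]
    _ = Real.exp ε * ∑ D : Dataset n d, ∑ x, ∑ x', dataWeightTwo D x x' *
        (M D).real {a | t < score a x' x} + δ := by
        rw [← hswap]
        simp only [mul_add, sum_add_distrib, ← sum_mul, htot, one_mul]
        congr 1
        simp only [mul_sum]
        exact sum_congr rfl fun D _ => sum_congr rfl fun x _ => sum_congr rfl fun x' _ => by ring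
    _ ≤ _ := by
        gcongr
        calc _ ≤ ∑ D : Dataset n d, dataWeight D * Real.exp (-(2 * t ^ 2 / d)) :=
              sum_le_sum fun D _ => by
                have := hM D
                exact sum_score_law_le (M D) D ht hd
          _ = _ := by rw [← sum_mul, sum_dataWeight, one_mul]

/-- In an accurate and differentially private mechanism, often no row stands out. -/
lemma two_thirds_le_undetected {M : Dataset n d → Measure (Fin d → ℝ)}
    (hM : ∀ D, IsProbabilityMeasure (M D)) {ε δ t : ℝ} (hDP : IsDP M ε δ)
    (hacc : IsAccurate M (1 / 3) (1 / 3)) (ht : 0 ≤ t) (hd : 0 < d) :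
    2 / 3 ≤ ∑ D : Dataset n d, ∑ x, dataWeightOne D x * (M D).real {a | Undetected D x t a} +
      n * (Real.exp ε * Real.exp (-(2 * t ^ 2 / d)) + δ) := by
  have h1 (D : Dataset n d) (x : Fin d → Bool) : 2 / 3 ≤ (M D).real {a | Undetected D x t a} +
      ∑ i, (M D).real {a | t < score a (D i) x} := by
    have := hM D
    have h2 := hacc D
    have hsub : {a | ∀ j, |marginal D j - a j| ≤ 1 / 3} ⊆
        {a | Undetected D x t a} ∪ ⋃ i, {a | t < score a (D i) x} := by
      intro a ha
      by_cases h : ∀ i, score a (D i) x ≤ t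
      · exact Or.inl ⟨ha, h⟩
      · push Not at h
        exact Or.inr (by simpa using h)
    have h3 := (measureReal_mono hsub).trans (measureReal_union_le (μ := M D) _ _)
    have h4 := measureReal_iUnion_fintype_le (μ := M D) fun i => {a | t < score a (D i) x}
    linarith
  have htot : ∑ D : Dataset n d, ∑ x, dataWeightOne D x = 1 := by
    simp only [sum_dataWeightOne, sum_dataWeight]
  calc (2 / 3 : ℝ) = ∑ D : Dataset n d, ∑ x, dataWeightOne D x * (2 / 3) := by
        simp only [← sum_mul, htot, one_mul]
    _ ≤ ∑ D : Dataset n d, ∑ x, dataWeightOne D x * ((M D).real {a | Undetected D x t a} +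
          ∑ i, (M D).real {a | t < score a (D i) x}) :=
        sum_le_sum fun D _ => sum_le_sum fun x _ =>
          mul_le_mul_of_nonneg_left (h1 D x) (dataWeightOne_nonneg _ _)
    _ = ∑ D : Dataset n d, ∑ x, dataWeightOne D x * (M D).real {a | Undetected D x t a} +
        ∑ i, ∑ D : Dataset n d, ∑ x, dataWeightOne D x * (M D).real {a | t < score a (D i) x} := by
        simp only [mul_add, sum_add_distrib, mul_sum]
        congr 1
        rw [sum_congr rfl fun D _ => sum_comm, sum_comm]
    _ ≤ _ := by
        gcongr
        calc _ ≤ ∑ _i : Fin n, (Real.exp ε * Real.exp (-(2 * t ^ 2 / d)) + δ) :=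
              sum_le_sum fun i _ => sum_row_score_le hM hDP ht hd i
          _ = _ := by simp [mul_add]

/-- An algorithm with few queries rarely gives accurate estimates with no row standing out. -/
lemma sum_undetected_le {F : Type v} [Field F] [Fintype F] [DecidableEq F]
    (hF : 4 * d < Fintype.card F) {A : Algorithm.{u} n d F} {s m r : ℕ}
    (hA : HasQueryComplexity A s) (hn : n = m + r)
    (hm : ∀ c : ℕ, c ≤ n → c * (d + 1) ≤ s → c ≤ m) {lam t : ℝ} (h0 : 0 ≤ lam) :
    ∑ D : Dataset n d, ∑ x, dataWeightOne D x * (outputLaw A D).real {a | Undetected D x t a} ≤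
      Real.exp (lam * (m * t)) * (∑ y : Fin m → Bool, bestValue m (Fin r) lam y) ^ d := by
  classical
  let _ := A.measurableSpaceCoins
  have := A.isProbabilityMeasure
  set N : ℝ := (Fintype.card (Fin n → RowSeed F d) : ℝ) with hN
  have hN0 : 0 < N := Nat.cast_pos.2 (card_rowSeed_pos hF)
  set T : (Fin m → Fin d → Bool) → ℝ := fun Y =>
    Real.exp (lam * (m * t)) * ∏ j, bestValue m (Fin r) lam fun l => Y l j with hT
  have hTsum : ∑ Y, T Y =
      Real.exp (lam * (m * t)) * (∑ y : Fin m → Bool, bestValue m (Fin r) lam y) ^ d := by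
    rw [hT, ← mul_sum, sum_prod_column fun _ => bestValue m (Fin r) lam]
    simp
  set G : Dataset n d → (Fin d → ℝ) → ℝ := fun D a =>
    ∑ x, dataWeightOne D x * (if Undetected D x t a then 1 else 0) with hG
  -- Fixed coins leave a deterministic tree, to which the simulation applies.
  have hpoint (ω : A.Coins) : ∑ D : Dataset n d, ∑ ρ : Fin n → RowSeed F d,
      G D ((A.tree ω).run (shareOracle D ρ)) ≤ N * ∑ Y, T Y := by
    refine sum_sum_run_le (f := rowShare) (κ := Fin r) isSecret_rowShare (by simpa using hn)
      (by simpa using hm) G T (fun Y => ?_) (fun a e Y => ?_) (A.tree ω) fun D ρ => hA ω D ρ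
    · exact mul_nonneg (Real.exp_pos _).le (prod_nonneg fun j _ => bestValue_nonneg h0 _)
    · exact sum_dataWeightOne_undetected_le (by simpa using hn) h0 a e Y
  have hmeas (D : Dataset n d) (x : Fin d → Bool) (ρ : Fin n → RowSeed F d) :
      MeasurableSet {ω | Undetected D x t ((A.tree ω).run (shareOracle D ρ))} :=
    A.measurable_run _ (measurableSet_undetected D x t)
  have hint (D : Dataset n d) (x : Fin d → Bool) (ρ : Fin n → RowSeed F d) :
      Integrable (fun ω => dataWeightOne D x *
        if Undetected D x t ((A.tree ω).run (shareOracle D ρ)) then (1 : ℝ) else 0) A.coinLaw :=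
    (integrable_ite A.coinLaw (hmeas D x ρ)).const_mul _
  have hintG (D : Dataset n d) (ρ : Fin n → RowSeed F d) :
      Integrable (fun ω => G D ((A.tree ω).run (shareOracle D ρ))) A.coinLaw :=
    integrable_finsetSum _ fun x _ => hint D x ρ
  have hD (D : Dataset n d) : ∑ x, dataWeightOne D x * (outputLaw A D).real {a | Undetected D x t a} =
      N⁻¹ * ∑ ρ : Fin n → RowSeed F d, ∫ ω, G D ((A.tree ω).run (shareOracle D ρ)) ∂A.coinLaw := by
    have h (x : Fin d → Bool) : dataWeightOne D x * (outputLaw A D).real {a | Undetected D x t a} =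
        N⁻¹ * ∑ ρ : Fin n → RowSeed F d, ∫ ω, dataWeightOne D x *
          (if Undetected D x t ((A.tree ω).run (shareOracle D ρ)) then (1 : ℝ) else 0) ∂A.coinLaw := by
      rw [outputLaw_real A D (measurableSet_undetected D x t), mul_left_comm, mul_sum]
      congr 1
      refine sum_congr rfl fun ρ _ => ?_
      rw [integral_const_mul, ← real_setOf_eq_integral A.coinLaw (hmeas D x ρ)]
      rfl
    simp only [h]
    rw [← mul_sum, sum_comm]
    congr 1
    refine sum_congr rfl fun ρ _ => ?_
    rw [hG, ← integral_finsetSum _ fun x _ => hint D x ρ]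
  simp only [hD]
  rw [← mul_sum]
  calc _ = N⁻¹ * ∫ ω, ∑ D : Dataset n d, ∑ ρ : Fin n → RowSeed F d,
        G D ((A.tree ω).run (shareOracle D ρ)) ∂A.coinLaw := by
        rw [integral_finsetSum _ fun D _ => integrable_finsetSum _ fun ρ _ => hintG D ρ]
        congr 1
        refine sum_congr rfl fun D _ => ?_
        rw [integral_finsetSum _ fun ρ _ => hintG D ρ]
    _ ≤ N⁻¹ * ∫ _ω, N * ∑ Y, T Y ∂A.coinLaw := by
        refine mul_le_mul_of_nonneg_left (integral_mono ?_ (integrable_const _) hpoint) (inv_nonneg.2 hN0.le)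
        exact integrable_finsetSum _ fun D _ => integrable_finsetSum _ fun ρ _ => hintG D ρ
    _ = _ := by
        rw [← hTsum]
        simp [hN0.ne']

end Attack

end SecretSharing

/-! ### Choice of parameters and conclusion -/

namespace SecretSharing

open Finset MeasureTheory

lemma accurate_private_tradeoff {n d : ℕ} {F : Type v} [Field F] [Fintype F] [DecidableEq F]
    (hF : 4 * d < Fintype.card F) {A : Algorithm.{u} n d F} {s m r : ℕ} {ε δ : ℝ}
    (hA : HasQueryComplexity A s) (hacc : IsAccurate (outputLaw A) (1 / 3) (1 / 3))
    (hDP : IsDP (outputLaw A) ε δ) (hn : n = m + r)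
    (hm : ∀ c : ℕ, c ≤ n → c * (d + 1) ≤ s → c ≤ m) (hm0 : 0 < m) (hd : 0 < d) :
    2 / 3 ≤ Real.exp (-(d / m ^ 2 / 4608)) +
      n * (Real.exp ε * Real.exp (-(d / m ^ 2 / 18432)) + δ) := by
  have hm1 : (1 : ℝ) ≤ m := by exact_mod_cast hm0
  have hd0 : (0 : ℝ) < d := by exact_mod_cast hd
  -- This `lam` minimises `-lam / 48 + (lam * m)² / 4`, with minimum `-1 / (2304 m²)`. The next
  -- choice, of `t`, makes `lam * m * t` half of `d / (2304 m²)`.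
  set lam : ℝ := 1 / (24 * m ^ 2) with hlam
  set t : ℝ := d / (192 * m) with ht
  have hlam0 : 0 ≤ lam := by positivity
  have hlamm : lam * m ≤ 1 := by
    rw [hlam, div_mul_eq_mul_div, div_le_one (by positivity)]
    nlinarith
  have hlam1 : lam ≤ 1 / 4 := by
    rw [hlam]
    exact one_div_le_one_div_of_le (by norm_num) (by nlinarith)
  have h1 := two_thirds_le_undetected (isProbabilityMeasure_outputLaw hF A) hDP hacc
    (t := t) (by positivity) hd
  have h2 := sum_undetected_le hF hA hn hm hlam0 (t := t)
  have h3 : (∑ y : Fin m → Bool, bestValue m (Fin r) lam y) ^ d ≤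
      Real.exp (-(d / (2304 * m ^ 2))) := by
    have h4 := sum_bestValue_le (κ := Fin r) hlam0 hlam1 hm0 hlamm
    have h5 : 1 - lam / 48 + (lam * m) ^ 2 / 4 = -(1 / (2304 * m ^ 2)) + 1 := by
      rw [hlam]; field_simp; ring
    rw [h5] at h4
    calc _ ≤ Real.exp (-(1 / (2304 * m ^ 2))) ^ d :=
          pow_le_pow_left₀ (sum_nonneg fun y _ => bestValue_nonneg hlam0 y)
            (h4.trans (Real.add_one_le_exp _)) d
      _ = _ := by rw [← Real.exp_nat_mul]; congr 1; ring
  have h6 : Real.exp (lam * (m * t)) * (∑ y : Fin m → Bool, bestValue m (Fin r) lam y) ^ d ≤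
      Real.exp (-(d / m ^ 2 / 4608)) := by
    refine (mul_le_mul_of_nonneg_left h3 (Real.exp_pos _).le).trans (le_of_eq ?_)
    rw [← Real.exp_add, hlam, ht]
    congr 1
    field_simp
    ring
  have h7 : 2 * t ^ 2 / d = d / m ^ 2 / 18432 := by
    rw [ht]; field_simp; ring
  rw [h7] at h1
  linarith

lemma exists_threshold (ε : ℝ) (K : ℝ) (hK : 0 < K) :
    ∃ d₀ : ℕ, 12 ≤ d₀ ∧ ∀ d : ℕ, d₀ ≤ d → 12 * Real.exp ε ≤ d ∧ 4 * K * Real.log d ≤ d := by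
  have h1 : ∀ᶠ d : ℕ in Filter.atTop, 12 * Real.exp ε ≤ (d : ℝ) :=
    tendsto_natCast_atTop_atTop.eventually_ge_atTop _
  have h2 : ∀ᶠ d : ℕ in Filter.atTop, 4 * K * Real.log d ≤ (d : ℝ) := by
    have h := (Real.isLittleO_log_id_atTop.comp_tendsto (tendsto_natCast_atTop_atTop (R := ℝ))).bound
      (c := (4 * K)⁻¹) (by positivity)
    filter_upwards [h] with d hd
    simp only [Function.comp_apply, id, Real.norm_eq_abs, Nat.abs_cast] at hd
    have := (le_abs_self _).trans hd
    rwa [inv_mul_eq_div, le_div_iff₀ (by positivity), mul_comm] at this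
  obtain ⟨d₁, h⟩ := Filter.eventually_atTop.1 (h1.and h2)
  exact ⟨max 12 d₁, le_max_left _ _, fun d hd => h d ((le_max_right _ _).trans hd)⟩

/-- The number of rows that an accurate and private algorithm has to learn about. -/
lemma div_sq_lt_of_accurate_private {n d k : ℕ} {F : Type v} [Field F] [Fintype F] [DecidableEq F]
    (hF : 4 * d < Fintype.card F) {A : Algorithm.{u} n d F} {s m r : ℕ} {ε δ : ℝ}
    (hA : HasQueryComplexity A s) (hacc : IsAccurate (outputLaw A) (1 / 3) (1 / 3))
    (hDP : IsDP (outputLaw A) ε δ) (hn : n = m + r)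
    (hm : ∀ c : ℕ, c ≤ n → c * (d + 1) ≤ s → c ≤ m) (hm0 : 0 < m) (hd : 12 ≤ d)
    (hε : 12 * Real.exp ε ≤ d) (hnk : n ≤ d ^ k) (hδ : δ ≤ 1 / 4 / n) :
    (d : ℝ) / m ^ 2 < 18432 * (k + 1) * Real.log d := by
  by_contra! h
  have hd' : (12 : ℝ) ≤ d := by exact_mod_cast hd
  have hd0 : (0 : ℝ) < d := by linarith
  have hn0 : (0 : ℝ) < n := by exact_mod_cast (by omega : 0 < n)
  have hnk' : (n : ℝ) ≤ d ^ k := by exact_mod_cast hnk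
  have key := accurate_private_tradeoff hF hA hacc hDP hn hm hm0 (by omega)
  have hlog : 0 ≤ Real.log d := Real.log_nonneg (by linarith)
  have he : Real.exp (-((k + 1) * Real.log d)) = ((d : ℝ) ^ (k + 1))⁻¹ := by
    rw [Real.exp_neg]
    congr 1
    rw [show ((k : ℝ) + 1) * Real.log d = ((k + 1 : ℕ) : ℝ) * Real.log d by push_cast; ring,
      Real.exp_nat_mul, Real.exp_log hd0]
  have h1 : Real.exp (-(d / m ^ 2 / 18432)) ≤ ((d : ℝ) ^ (k + 1))⁻¹ := by
    rw [← he]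
    refine Real.exp_le_exp.2 (neg_le_neg ?_)
    rw [le_div_iff₀ (by norm_num)]
    linarith
  have h2 : Real.exp (-(d / m ^ 2 / 4608)) ≤ 1 / 12 := by
    have h3 : Real.exp (-(d / m ^ 2 / 4608)) ≤ Real.exp (-Real.log d) := by
      refine Real.exp_le_exp.2 (neg_le_neg ?_)
      rw [le_div_iff₀ (by norm_num)]
      nlinarith [mul_nonneg (Nat.cast_nonneg (α := ℝ) k) hlog]
    rw [Real.exp_neg (Real.log d), Real.exp_log hd0] at h3
    refine h3.trans ?_
    rw [one_div]
    exact inv_anti₀ (by norm_num) hd'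
  have h4 : n * (Real.exp ε * Real.exp (-(d / m ^ 2 / 18432))) ≤ 1 / 12 := by
    calc _ ≤ (d : ℝ) ^ k * (Real.exp ε * ((d : ℝ) ^ (k + 1))⁻¹) := by gcongr
      _ = Real.exp ε / d := by rw [pow_succ]; field_simp
      _ ≤ 1 / 12 := by rw [div_le_iff₀ hd0]; linarith
  have h5 : n * δ ≤ 1 / 4 := by
    rw [le_div_iff₀ hn0] at hδ
    linarith
  -- The right side of `key` is at most `1/12 + 1/12 + 1/4 = 5/12 < 2/3`.
  linarith

end SecretSharing

theorem theorem4p9 (ε : ℝ) (k : ℕ) :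
    ∃ γ : ℝ, 0 < γ ∧ ∃ c : ℝ, 0 < c ∧ ∃ d₀ : ℕ,
      ∀ (n d : ℕ), d₀ ≤ d → 1 ≤ n → n ≤ d ^ k →
      ∀ (F : Type v) [Field F] [Fintype F] [DecidableEq F], 4 * d < Fintype.card F →
      ∀ (A : SecretSharing.Algorithm.{u} n d F) (s : ℕ) (δ : ℝ), δ ≤ γ / n →
        SecretSharing.HasQueryComplexity A s →
        SecretSharing.IsAccurate (SecretSharing.outputLaw A) (1 / 3) (1 / 3) →
        SecretSharing.IsDP (SecretSharing.outputLaw A) ε δ →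
        c * ((d : ℝ) * √((d : ℝ) / Real.log d)) ≤ s ∧
        ∀ B : ℝ, 0 < B → (n : ℝ) ≤ B * √(d : ℝ) →
          c / B * (((n : ℝ) * d) / √(Real.log ((n : ℝ) * d))) ≤ s := by
  have hK : (0 : ℝ) < 18432 * (k + 1) := by positivity
  set K : ℝ := 18432 * (k + 1) with hKdef
  obtain ⟨d₀, hd₀, hd₀'⟩ := SecretSharing.exists_threshold ε K hK
  have hc : 0 < 1 / (2 * √K) := by positivity
  set c : ℝ := 1 / (2 * √K) with hcdef
  refine ⟨1 / 4, by norm_num, c, hc, d₀, ?_⟩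
  intro n d hd hn hnk F _ _ _ hF A s δ hδ hA hacc hDP
  obtain ⟨hε, hKd⟩ := hd₀' d hd
  have hd12 : 12 ≤ d := hd₀.trans hd
  have hdR : (12 : ℝ) ≤ d := by exact_mod_cast hd12
  have hd0 : (0 : ℝ) < d := by linarith
  have hlog : 0 < Real.log d := Real.log_pos (by linarith)
  have hn1 : (1 : ℝ) ≤ n := by exact_mod_cast hn
  have hfirst : c * ((d : ℝ) * √((d : ℝ) / Real.log d)) ≤ s := by
    -- The `+ 1` keeps `m` positive when `s < d`.
    set m : ℕ := min n (s / d + 1) with hmdef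
    have hm0 : 0 < m := lt_min hn (Nat.succ_pos _)
    have hmn : m ≤ n := min_le_left _ _
    have hm : ∀ c : ℕ, c ≤ n → c * (d + 1) ≤ s → c ≤ m := by
      intro c hc1 hc2
      refine le_min hc1 (Nat.le_succ_of_le ?_)
      rw [Nat.le_div_iff_mul_le (by omega)]
      nlinarith
    have hlt := SecretSharing.div_sq_lt_of_accurate_private (r := n - m) hF hA hacc hDP (by omega) hm hm0 hd12 hε hnk hδ
    have hm0' : (0 : ℝ) < m := by exact_mod_cast hm0
    have hms : (m : ℝ) ≤ s / d + 1 := by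
      have h1 : (m : ℝ) ≤ (s / d : ℕ) + 1 := by exact_mod_cast min_le_right n (s / d + 1)
      linarith [Nat.cast_div_le (α := ℝ) (m := s) (n := d)]
    set x : ℝ := √((d : ℝ) / Real.log d) with hx
    have hx0 : 0 ≤ x := Real.sqrt_nonneg _
    have hxsq : x ^ 2 = d / Real.log d := Real.sq_sqrt (by positivity)
    have hKsq : √K ^ 2 = K := Real.sq_sqrt hK.le
    have hKpos : 0 < √K := Real.sqrt_pos.2 hK
    have hcx : 2 * (c * x) = x / √K := by rw [hcdef]; field_simp
    have hlow : x / √K ≤ m := by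
      refine abs_le_of_sq_le_sq' ?_ hm0'.le |>.2
      rw [div_pow, hxsq, hKsq, div_div, div_le_iff₀ (by positivity)]
      rw [div_lt_iff₀ (by positivity)] at hlt
      nlinarith
    -- From `4 * K * log d ≤ d`; it lets half of `x / √K` absorb the `+ 1` in `m`, whence the factor
    -- `2` in `c`.
    have htwo : 2 ≤ x / √K := by
      refine abs_le_of_sq_le_sq' (b := x / √K) ?_ (by positivity) |>.2
      rw [div_pow, hxsq, hKsq, div_div, le_div_iff₀ (by positivity)]
      nlinarith
    have h3 : c * x ≤ s / d := by linarith
    rw [le_div_iff₀ hd0] at h3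
    linarith
  refine ⟨hfirst, fun B hB hnB => ?_⟩
  -- As `n ≥ 1`, passing from `log (n * d)` to `log d` only enlarges the quotient, so the same `c`
  -- serves.
  have hlog' : Real.log d ≤ Real.log ((n : ℝ) * d) :=
    Real.log_le_log hd0 (le_mul_of_one_le_left hd0.le hn1)
  calc c / B * (((n : ℝ) * d) / √(Real.log ((n : ℝ) * d)))
      ≤ c / B * ((B * √(d : ℝ) * d) / √(Real.log d)) := by
        gcongr
    _ = c * ((d : ℝ) * √((d : ℝ) / Real.log d)) := by
        rw [Real.sqrt_div hd0.le]
        field_simp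
    _ ≤ s := hfirst
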